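/- Let $A$ and $B$ be $C^*$-algebras (trivially graded, not necessarily unital). An \emph{ungraded Kasparov $A$-$B$-module} is a triple $(\mathcal E,\pi,F)$ where $\mathcal E$ is a countably generated Hilbert $B$-module, $\pi:A\to\mathcal L(\mathcal E)$ is a $*$-homomorphism into the adjointable operators of $\mathcal E$, and $F\in\mathcal L(\mathcal E)$ satisfies $\pi(a)(F^2-1)\in\mathcal K(\mathcal E)$ and $[\pi(a),F]\in\mathcal K(\mathcal E)$ for all $a\in A$, where $\mathcal K(\mathcal E)$ is the set of compact operators of $\mathcal E$. Let $E^1(A,B)$ be the set of these triples. If $B'$ is a $\mathbb Z/2\mathbb Z$-graded $C^*$-algebra, a \emph{Kasparov $A$-$B'$-module} is a triple as above (with $B'$ in place of $B$) in which $\mathcal E$ is a $\mathbb Z/2\mathbb Z$-graded Hilbert $B'$-module, $\pi$ has degree $0$ and $F$ has degree $1$; the set of these is $E(A,B')$. A \emph{homotopy} between two (graded or ungraded) modules $x,x'$ over $B'$ is a module $\tilde x$ of the same kind over $C([0,1],B')$ whose pushforwards along the evaluations at $0$ and $1$ are, up to (grading-preserving) unitary equivalence, $x$ and $x'$; here the pushforward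 of $(\mathcal E,\pi,F)$ along $g:B'\to B''$ is $(\mathcal E\otimes_g B'',\pi\otimes 1,F\otimes 1)$. Homotopy is an equivalence relation, and the direct sum $(\mathcal E\oplus\mathcal E',\pi\oplus\pi',F\oplus F')$ makes the homotopy classes into abelian groups; $KK(A,B')$ is the group of homotopy classes of $E(A,B')$. Let $C_1=\mathbb C\oplus\varepsilon\mathbb C$ be the $C^*$-algebra with $\varepsilon^*=\varepsilon$ and $\varepsilon^2=1$, graded so that $\varepsilon$ has degree $1$. Grade $B\otimes C_1$ and $\mathcal E\otimes C_1$ by the grading of $C_1$. Then the map $$E^1(A,B)\longrightarrow E(A,B\otimes C_1),\qquad (\mathcal E,\pi,F)\longmapsto(\mathcal E\otimes C_1,\ \pi\otimes\mathrm{Id},\ F\otimes\varepsilon)$$ is well defined and induces an isomorphism of abelian groups from the quotient of $E^1(A,B)$ under homotopy onto $KK_1(A,B)=KK(A,B\otimes C_1)$. -/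

import Mathlib

namespace KKTheory

set_option linter.unusedSectionVars false
set_option linter.unusedSimpArgs false

open MulOpposite
open scoped RightActions unitInterval InnerProductSpace

noncomputable section

universe u v

/-! ### Hilbert modules -/

/-- A right pre-Hilbert module `E` over a C⋆-algebra `B`: a complex vector space with a right
action of `B` (written `x <• b`) and a `B`-valued form `⟪x, y⟫_B`, linear and `B`-linear in the
second variable, hermitian and positive (the positive elements of a C⋆-algebra are those of the
form `b⋆ b`), together with the norm `‖x‖ = ‖⟪x, x⟫‖ ^ (1/2)`. If that is a norm, the form is
definite, and the usual module laws, such as `x <• (b * c) = (x <• b) <• c`, follow from it.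
Mathlib's `CStarModule B E` is the variant in which `⟪x, b • y⟫ = b * ⟪x, y⟫`. -/
class HilbertModule (B E : Type*) [NonUnitalCStarAlgebra B] [AddCommGroup E] [Module ℂ E]
    [SMul Bᵐᵒᵖ E] [Norm E] extends Inner B E where
  inner_add_right (x y z : E) : inner x (y + z) = inner x y + inner x z
  inner_smul_right (c : ℂ) (x y : E) : inner x (c • y) = c • inner x y
  inner_op_smul_right (b : B) (x y : E) : inner x (y <• b) = inner x y * b
  star_inner (x y : E) : star (inner x y) = inner y x
  inner_self_pos (x : E) : ∃ b : B, inner x x = star b * b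
  inner_self_eq_zero (x : E) : inner x x = 0 → x = 0
  norm_eq (x : E) : ‖x‖ = √‖inner x x‖

namespace HilbertModule

section Basic

variable {B E : Type*} [NonUnitalCStarAlgebra B] [AddCommGroup E] [Module ℂ E]
  [SMul Bᵐᵒᵖ E] [Norm E] [HilbertModule B E]

theorem inner_add_left (x y z : E) : ⟪x + y, z⟫_B = ⟪x, z⟫_B + ⟪y, z⟫_B := by
  rw [← star_inner z (x + y), inner_add_right, star_add, star_inner, star_inner]

theorem inner_smul_left (c : ℂ) (x y : E) : ⟪c • x, y⟫_B = star c • ⟪x, y⟫_B := by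
  rw [← star_inner y (c • x), inner_smul_right, star_smul, star_inner]

theorem inner_op_smul_left (b : B) (x y : E) : ⟪x <• b, y⟫_B = star b * ⟪x, y⟫_B := by
  rw [← star_inner y (x <• b), inner_op_smul_right, star_mul, star_inner]

theorem inner_zero_right (x : E) : ⟪x, (0 : E)⟫_B = 0 := by
  simpa using inner_smul_right (B := B) 0 x (0 : E)

theorem inner_neg_right (x y : E) : ⟪x, -y⟫_B = -⟪x, y⟫_B := by
  simpa using inner_smul_right (B := B) (-1) x y

theorem inner_sub_right (x y z : E) : ⟪x, y - z⟫_B = ⟪x, y⟫_B - ⟪x, z⟫_B := by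
  rw [sub_eq_add_neg, inner_add_right, inner_neg_right, sub_eq_add_neg]

theorem inner_zero_left (x : E) : ⟪(0 : E), x⟫_B = 0 := by
  rw [← star_inner x (0 : E), inner_zero_right, star_zero]

theorem inner_neg_left (x y : E) : ⟪-x, y⟫_B = -⟪x, y⟫_B := by
  rw [← star_inner y (-x), inner_neg_right, star_neg, star_inner]

theorem inner_sub_left (x y z : E) : ⟪x - y, z⟫_B = ⟪x, z⟫_B - ⟪y, z⟫_B := by
  rw [sub_eq_add_neg, inner_add_left, inner_neg_left, sub_eq_add_neg]

variable (B) in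
theorem ext_inner {x y : E} (h : ∀ z : E, ⟪z, x⟫_B = ⟪z, y⟫_B) : x = y := by
  refine sub_eq_zero.mp (inner_self_eq_zero (B := B) _ ?_)
  rw [inner_sub_right, h, sub_self]

theorem add_op_smul (x y : E) (b : B) : (x + y) <• b = x <• b + y <• b :=
  ext_inner B fun z => by simp only [inner_op_smul_right, inner_add_right, add_mul]

theorem op_smul_add (x : E) (b c : B) : x <• (b + c) = x <• b + x <• c :=
  ext_inner B fun z => by simp only [inner_op_smul_right, inner_add_right, mul_add]

theorem zero_op_smul (b : B) : (0 : E) <• b = 0 :=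
  ext_inner B fun z => by simp only [inner_op_smul_right, inner_zero_right, zero_mul]

theorem op_smul_zero (x : E) : x <• (0 : B) = 0 :=
  ext_inner B fun z => by simp only [inner_op_smul_right, inner_zero_right, mul_zero]

theorem neg_op_smul (x : E) (b : B) : (-x) <• b = -(x <• b) :=
  ext_inner B fun z => by simp only [inner_op_smul_right, inner_neg_right, neg_mul]

theorem op_smul_neg (x : E) (b : B) : x <• (-b) = -(x <• b) :=
  ext_inner B fun z => by simp only [inner_op_smul_right, inner_neg_right, mul_neg]

theorem op_smul_smul (c : ℂ) (x : E) (b : B) : x <• (c • b) = c • (x <• b) :=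
  ext_inner B fun z => by simp only [inner_op_smul_right, inner_smul_right, mul_smul_comm]

theorem smul_op_smul (c : ℂ) (x : E) (b : B) : (c • x) <• b = c • (x <• b) :=
  ext_inner B fun z => by simp only [inner_op_smul_right, inner_smul_right, smul_mul_assoc]

variable (B E) in
/-- A right pre-Hilbert `B`-module is one of Mathlib's modules over the opposite algebra. -/
abbrev toCStarModule :
    let _ := CStarAlgebra.spectralOrder Bᵐᵒᵖ
    CStarModule Bᵐᵒᵖ E :=
  let _ := CStarAlgebra.spectralOrder Bᵐᵒᵖ
  have _ := CStarAlgebra.spectralOrderedRing Bᵐᵒᵖ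
  { inner := fun x y => op ⟪x, y⟫_B
    inner_add_right := by intro x y z; rw [inner_add_right, op_add]
    inner_self_nonneg := by
      intro x
      obtain ⟨b, hb⟩ := inner_self_pos (B := B) x
      rw [hb, op_mul, op_star]
      exact mul_star_self_nonneg _
    inner_self := by
      intro x
      refine ⟨fun h => inner_self_eq_zero (B := B) x (op_injective h), ?_⟩
      rintro rfl
      rw [inner_zero_right, op_zero]
    inner_op_smul_right := by
      intro a x y
      obtain ⟨b, rfl⟩ := op_surjective a
      rw [inner_op_smul_right, op_mul]
    inner_smul_right_complex := by intro c x y; rw [inner_smul_right, op_smul]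
    star_inner := by intro x y; rw [← op_star, star_inner]
    norm_eq_sqrt_norm_inner_self := by intro x; rw [norm_eq (B := B) x]; rfl }

theorem normedSpaceCore (B E : Type*) [NonUnitalCStarAlgebra B] [AddCommGroup E] [Module ℂ E]
    [SMul Bᵐᵒᵖ E] [Norm E] [HilbertModule B E] : NormedSpace.Core ℂ E :=
  let _ := CStarAlgebra.spectralOrder Bᵐᵒᵖ
  have _ := CStarAlgebra.spectralOrderedRing Bᵐᵒᵖ
  let _ := toCStarModule B E
  CStarModule.normedSpaceCore Bᵐᵒᵖ

theorem norm_inner_le (x y : E) : ‖⟪x, y⟫_B‖ ≤ ‖x‖ * ‖y‖ :=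
  let _ := CStarAlgebra.spectralOrder Bᵐᵒᵖ
  have _ := CStarAlgebra.spectralOrderedRing Bᵐᵒᵖ
  let _ := toCStarModule B E
  CStarModule.norm_inner_le (A := Bᵐᵒᵖ) E (x := x) (y := y)

theorem norm_sq_eq (x : E) : ‖x‖ ^ 2 = ‖⟪x, x⟫_B‖ := by
  rw [norm_eq (B := B), Real.sq_sqrt (norm_nonneg _)]

end Basic

section Complete

variable {B E : Type*} [NonUnitalCStarAlgebra B] [NormedAddCommGroup E] [NormedSpace ℂ E]
  [SMul Bᵐᵒᵖ E] [HilbertModule B E]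

theorem norm_op_smul_le (x : E) (b : B) : ‖x <• b‖ ≤ ‖x‖ * ‖b‖ := by
  refine le_of_sq_le_sq ?_ (by positivity)
  rw [norm_sq_eq (B := B), inner_op_smul_right, inner_op_smul_left, mul_assoc]
  calc _ ≤ ‖star b‖ * (‖⟪x, x⟫_B‖ * ‖b‖) :=
        (norm_mul_le _ _).trans (by gcongr; exact norm_mul_le _ _)
    _ = (‖x‖ * ‖b‖) ^ 2 := by rw [norm_star, ← norm_sq_eq]; ring

variable (B E) in
/-- The form as a continuous sesquilinear map. -/
def innerL : E →L⋆[ℂ] E →L[ℂ] B :=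
  LinearMap.mkContinuous₂
    (LinearMap.mk₂'ₛₗ (starRingEnd ℂ) (RingHom.id ℂ) (fun x y : E => ⟪x, y⟫_B) inner_add_left
      inner_smul_left inner_add_right inner_smul_right) 1
    fun x y => by simpa using norm_inner_le x y

variable (B E) in
/-- The right action as a continuous bilinear map. -/
def actionL : E →L[ℂ] B →L[ℂ] E :=
  LinearMap.mkContinuous₂
    (LinearMap.mk₂ ℂ (fun (x : E) (b : B) => x <• b) add_op_smul smul_op_smul op_smul_add
      op_smul_smul) 1
    fun x b => by simpa using norm_op_smul_le x b

theorem continuous_inner {X : Type*} [TopologicalSpace X] {f g : X → E} (hf : Continuous f)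
    (hg : Continuous g) : Continuous fun t => ⟪f t, g t⟫_B :=
  ((innerL B E).continuous.comp hf).clm_apply hg

theorem continuous_op_smul {X : Type*} [TopologicalSpace X] {f : X → E} {b : X → B}
    (hf : Continuous f) (hb : Continuous b) : Continuous fun t => f t <• b t :=
  ((actionL B E).continuous.comp hf).clm_apply hb

end Complete

end HilbertModule

/-! ### Operators on Hilbert modules -/

section Operators

variable (B : Type*) {E : Type*} [NonUnitalCStarAlgebra B] [NormedAddCommGroup E]
  [NormedSpace ℂ E] [SMul Bᵐᵒᵖ E] [HilbertModule B E]

/-- `S` is the adjoint of `T`. -/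
def IsAdjoint (T S : E →L[ℂ] E) : Prop :=
  ∀ x y : E, ⟪T x, y⟫_B = ⟪x, S y⟫_B

/-- `T` is adjointable, that is, a homomorphism of Hilbert `B`-modules. -/
def IsAdjointable (T : E →L[ℂ] E) : Prop :=
  ∃ S : E →L[ℂ] E, IsAdjoint B T S

variable (E) in
/-- The operators `θ y x : z ↦ y <• ⟪x, z⟫`. -/
def rankOne : Set (E →L[ℂ] E) :=
  {T | ∃ y x : E, ∀ z : E, T z = y <• ⟪x, z⟫_B}

variable (E) in
/-- The compact operators of a Hilbert `B`-module: the norm closure of the linear span of the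
operators `θ y x`. -/
def compacts : Submodule ℂ (E →L[ℂ] E) :=
  (Submodule.span ℂ (rankOne B E)).topologicalClosure

variable (E) in
/-- There is a sequence in `E` whose `B`-linear combinations are dense in `E`. -/
def IsCountablyGenerated : Prop :=
  ∃ s : ℕ → E,
    (Submodule.span ℂ {x : E | ∃ (n : ℕ) (b : B), x = s n <• b}).topologicalClosure = ⊤

/-- Two submodules of operators or vectors defined as closed spans are compared on generators. -/
theorem map_closure_le {V W : Type*} [NormedAddCommGroup V] [NormedSpace ℂ V]
    [NormedAddCommGroup W] [NormedSpace ℂ W] (φ : V →L[ℂ] W) (s : Set V) (p : Submodule ℂ W)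
    (h : ∀ x ∈ s, φ x ∈ p.topologicalClosure) {x : V}
    (hx : x ∈ (Submodule.span ℂ s).topologicalClosure) : φ x ∈ p.topologicalClosure := by
  have h1 : (Submodule.span ℂ s).topologicalClosure ≤
      p.topologicalClosure.comap (φ : V →ₗ[ℂ] W) := by
    refine Submodule.topologicalClosure_minimal _ ?_ ?_
    · exact Submodule.span_le.mpr h
    · exact p.isClosed_topologicalClosure.preimage φ.continuous
  exact h1 hx

end Operators

/-! ### Gradings and the tensor product with the Clifford algebra `C₁` -/

/-- A `ℤ/2`-grading of a C⋆-algebra, given by its grading automorphism `α`: the elements of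
degree `i` are the `b` with `α b = (-1) ^ i • b`. -/
class CStarGrading (B : Type*) [NonUnitalCStarAlgebra B] where
  gradeHom : B →⋆ₙₐ[ℂ] B
  gradeHom_gradeHom (b : B) : gradeHom (gradeHom b) = b

open CStarGrading

/-- The C⋆-algebra `B ⊗ C₁`, where `C₁ = ℂ ⊕ ε ℂ` with `ε⋆ = ε` and `ε² = 1`. The pair `(a, b)`
stands for `a ⊗ 1 + b ⊗ ε`. -/
@[ext]
structure CliffordTensor (B : Type*) where
  even : B
  odd : B

namespace CliffordTensor

variable {B : Type*} [NonUnitalCStarAlgebra B]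

instance : Zero (CliffordTensor B) := ⟨⟨0, 0⟩⟩
instance : Add (CliffordTensor B) := ⟨fun x y => ⟨x.even + y.even, x.odd + y.odd⟩⟩
instance : Neg (CliffordTensor B) := ⟨fun x => ⟨-x.even, -x.odd⟩⟩
instance : Sub (CliffordTensor B) := ⟨fun x y => ⟨x.even - y.even, x.odd - y.odd⟩⟩
instance : SMul ℕ (CliffordTensor B) := ⟨fun n x => ⟨n • x.even, n • x.odd⟩⟩
instance : SMul ℤ (CliffordTensor B) := ⟨fun n x => ⟨n • x.even, n • x.odd⟩⟩
instance : SMul ℂ (CliffordTensor B) := ⟨fun c x => ⟨c • x.even, c • x.odd⟩⟩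
instance : Mul (CliffordTensor B) :=
  ⟨fun x y => ⟨x.even * y.even + x.odd * y.odd, x.even * y.odd + x.odd * y.even⟩⟩
instance : Star (CliffordTensor B) := ⟨fun x => ⟨star x.even, star x.odd⟩⟩

@[simp] theorem even_zero : (0 : CliffordTensor B).even = 0 := rfl
@[simp] theorem odd_zero : (0 : CliffordTensor B).odd = 0 := rfl
@[simp] theorem even_add (x y : CliffordTensor B) : (x + y).even = x.even + y.even := rfl
@[simp] theorem odd_add (x y : CliffordTensor B) : (x + y).odd = x.odd + y.odd := rfl
@[simp] theorem even_smul (c : ℂ) (x : CliffordTensor B) : (c • x).even = c • x.even := rfl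
@[simp] theorem odd_smul (c : ℂ) (x : CliffordTensor B) : (c • x).odd = c • x.odd := rfl
@[simp] theorem even_mul (x y : CliffordTensor B) :
    (x * y).even = x.even * y.even + x.odd * y.odd := rfl
@[simp] theorem odd_mul (x y : CliffordTensor B) :
    (x * y).odd = x.even * y.odd + x.odd * y.even := rfl
@[simp] theorem even_star (x : CliffordTensor B) : (star x).even = star x.even := rfl
@[simp] theorem odd_star (x : CliffordTensor B) : (star x).odd = star x.odd := rfl

/-- The two evaluations `ε ↦ 1` and `ε ↦ -1`. -/
def eval (x : CliffordTensor B) : B × B := (x.even + x.odd, x.even - x.odd)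

theorem eval_injective : Function.Injective (eval : CliffordTensor B → B × B) := by
  intro x y h
  have h1 : x.even + x.odd = y.even + y.odd := congrArg Prod.fst h
  have h2 : x.even - x.odd = y.even - y.odd := congrArg Prod.snd h
  have h3 : (2 : ℂ) • x.even = (2 : ℂ) • y.even := by
    rw [two_smul, two_smul]
    calc x.even + x.even = (x.even + x.odd) + (x.even - x.odd) := by abel
      _ = y.even + y.even := by rw [h1, h2]; abel
  have h4 : x.even = y.even := smul_right_injective B two_ne_zero h3
  have h5 : x.odd = y.odd := by rw [h4] at h1; exact add_left_cancel h1
  exact CliffordTensor.ext h4 h5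

theorem eval_surjective : Function.Surjective (eval : CliffordTensor B → B × B) := by
  rintro ⟨p, q⟩
  have h : ∀ b : B, (2⁻¹ : ℂ) • b + (2⁻¹ : ℂ) • b = b := fun b => by
    rw [← add_smul]; norm_num
  refine ⟨⟨(2⁻¹ : ℂ) • (p + q), (2⁻¹ : ℂ) • (p - q)⟩, Prod.ext ?_ ?_⟩
  · calc (2⁻¹ : ℂ) • (p + q) + (2⁻¹ : ℂ) • (p - q) = (2⁻¹ : ℂ) • p + (2⁻¹ : ℂ) • p := by
          rw [smul_add, smul_sub]; abel
      _ = p := h p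
  · calc (2⁻¹ : ℂ) • (p + q) - (2⁻¹ : ℂ) • (p - q) = (2⁻¹ : ℂ) • q + (2⁻¹ : ℂ) • q := by
          rw [smul_add, smul_sub]; abel
      _ = q := h q

theorem eval_mul (x y : CliffordTensor B) : eval (x * y) = eval x * eval y := by
  refine Prod.ext ?_ ?_
  · change x.even * y.even + x.odd * y.odd + (x.even * y.odd + x.odd * y.even)
      = (x.even + x.odd) * (y.even + y.odd)
    noncomm_ring
  · change x.even * y.even + x.odd * y.odd - (x.even * y.odd + x.odd * y.even)
      = (x.even - x.odd) * (y.even - y.odd)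
    noncomm_ring

theorem eval_add (x y : CliffordTensor B) : eval (x + y) = eval x + eval y := by
  refine Prod.ext ?_ ?_
  · change x.even + y.even + (x.odd + y.odd) = x.even + x.odd + (y.even + y.odd)
    abel
  · change x.even + y.even - (x.odd + y.odd) = x.even - x.odd + (y.even - y.odd)
    abel

theorem eval_smul (c : ℂ) (x : CliffordTensor B) : eval (c • x) = c • eval x :=
  Prod.ext (smul_add c x.even x.odd).symm (smul_sub c x.even x.odd).symm

theorem eval_star (x : CliffordTensor B) : eval (star x) = star (eval x) :=
  Prod.ext (star_add x.even x.odd).symm (star_sub x.even x.odd).symm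

instance : NonUnitalRing (CliffordTensor B) :=
  eval_injective.nonUnitalRing eval (by ext <;> simp [eval]) eval_add eval_mul
    (fun x => Prod.ext (neg_add x.even x.odd).symm
      (by change -x.even - -x.odd = -(x.even - x.odd); abel))
    (fun x y => Prod.ext
      (by change x.even - y.even + (x.odd - y.odd) = x.even + x.odd - (y.even + y.odd); abel)
      (by change x.even - y.even - (x.odd - y.odd) = x.even - x.odd - (y.even - y.odd); abel))
    (fun n x => Prod.ext (smul_add n x.even x.odd).symm (smul_sub n x.even x.odd).symm)
    (fun n x => Prod.ext (smul_add n x.even x.odd).symm (smul_sub n x.even x.odd).symm)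

/-- `eval` as a ring homomorphism. -/
def evalHom : CliffordTensor B →ₙ+* B × B where
  toFun := eval
  map_mul' := eval_mul
  map_zero' := by ext <;> simp [eval]
  map_add' := eval_add

instance : Module ℂ (CliffordTensor B) :=
  eval_injective.module ℂ (evalHom (B := B)).toAddMonoidHom eval_smul

/-- The C⋆-norm of `B ⊗ C₁`, which is `max ‖a + b‖ ‖a - b‖` since the two evaluations identify
`B ⊗ C₁` with `B ⊕ B`. -/
instance : NonUnitalNormedRing (CliffordTensor B) :=
  NonUnitalNormedRing.induced (CliffordTensor B) (B × B) evalHom eval_injective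

theorem norm_def (x : CliffordTensor B) : ‖x‖ = max ‖x.even + x.odd‖ ‖x.even - x.odd‖ := rfl

theorem isometry_eval : Isometry (eval : CliffordTensor B → B × B) :=
  AddMonoidHomClass.isometry_of_norm (evalHom (B := B)) fun _ => rfl

instance : StarRing (CliffordTensor B) where
  star_involutive x := eval_injective (by rw [eval_star, eval_star, star_star])
  star_mul x y := eval_injective (by simp only [eval_star, eval_mul, star_mul])
  star_add x y := eval_injective (by simp only [eval_star, eval_add, star_add])

instance : NonUnitalCStarAlgebra (CliffordTensor B) where
  complete := by
    intro f hf
    have h : IsUniformInducing (eval : CliffordTensor B → B × B) :=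
      isometry_eval.isUniformInducing
    have := (h.completeSpace_congr eval_surjective).mpr inferInstance
    exact this.complete hf
  norm_mul_self_le x := by
    change ‖eval x‖ * ‖eval x‖ ≤ ‖eval (star x * x)‖
    rw [eval_mul, eval_star, CStarRing.norm_star_mul_self]
  norm_smul_le c x := by
    change ‖eval (c • x)‖ ≤ ‖c‖ * ‖eval x‖
    rw [eval_smul, norm_smul]
  smul_assoc c x y := eval_injective (by
    simp only [smul_eq_mul, eval_mul, eval_smul, smul_mul_assoc])
  smul_comm c x y := eval_injective (by
    simp only [smul_eq_mul, eval_mul, eval_smul, mul_smul_comm])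
  star_smul c x := eval_injective (by simp only [eval_star, eval_smul, star_smul])

/-- The grading of `B ⊗ C₁` for which `B ⊗ 1` has degree `0` and `B ⊗ ε` has degree `1`. -/
instance : CStarGrading (CliffordTensor B) where
  gradeHom :=
    { toFun := fun x => ⟨x.even, -x.odd⟩
      map_smul' := fun c x => CliffordTensor.ext rfl (smul_neg c x.odd).symm
      map_zero' := CliffordTensor.ext rfl neg_zero
      map_add' := fun x y => CliffordTensor.ext rfl (neg_add x.odd y.odd)
      map_mul' := fun x y => CliffordTensor.ext (by simp)
        (by
          change -(x.even * y.odd + x.odd * y.even) = x.even * -y.odd + -x.odd * y.even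
          noncomm_ring)
      map_star' := fun x => CliffordTensor.ext rfl (star_neg x.odd).symm }
  gradeHom_gradeHom x := CliffordTensor.ext rfl (neg_neg x.odd)

@[simp] theorem gradeHom_even (x : CliffordTensor B) : (gradeHom x).even = x.even := rfl
@[simp] theorem gradeHom_odd (x : CliffordTensor B) : (gradeHom x).odd = -x.odd := rfl

end CliffordTensor

open scoped CStarAlgebra in
/-- The pointwise grading of `C([0, 1], B)`. -/
instance {B : Type*} [NonUnitalCStarAlgebra B] [CStarGrading B] : CStarGrading C(I, B) where
  gradeHom :=
    { toFun := fun f => ⟨fun t => gradeHom (f t), (map_continuous (gradeHom : B →⋆ₙₐ[ℂ] B)).comp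
        f.continuous⟩
      map_smul' := fun c f => by ext t; exact map_smul gradeHom c (f t)
      map_zero' := by ext t; exact map_zero gradeHom
      map_add' := fun f g => by ext t; exact map_add gradeHom (f t) (g t)
      map_mul' := fun f g => by ext t; exact map_mul gradeHom (f t) (g t)
      map_star' := fun f => by ext t; exact map_star gradeHom (f t) }
  gradeHom_gradeHom f := ContinuousMap.ext fun t => gradeHom_gradeHom (f t)

/-- Evaluation at `t`. -/
def evalAt (B : Type*) [NonUnitalCStarAlgebra B] (t : I) : C(I, B) →⋆ₙₐ[ℂ] B where
  toFun f := f t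
  map_smul' _ _ := rfl
  map_zero' := rfl
  map_add' _ _ := rfl
  map_mul' _ _ := rfl
  map_star' _ := rfl

/-! ### Kasparov modules and homotopies -/

/-- An ungraded Kasparov `A`-`B`-module `(E, π, F)`: a countably generated Hilbert `B`-module `E`,
a ⋆-homomorphism `π` from `A` to the adjointable operators of `E`, and an adjointable operator `F`
such that `π a (F² - 1)` and `[π a, F]` are compact. -/
structure UngradedKasparovModule (A : Type u) (B : Type v) [NonUnitalCStarAlgebra A]
    [NonUnitalCStarAlgebra B] where
  carrier : Type v
  [instGroup : NormedAddCommGroup carrier]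
  [instSpace : NormedSpace ℂ carrier]
  [instAction : SMul Bᵐᵒᵖ carrier]
  [instHilbert : HilbertModule B carrier]
  [instComplete : CompleteSpace carrier]
  countablyGenerated : IsCountablyGenerated B carrier
  π : A →ₙₐ[ℂ] (carrier →L[ℂ] carrier)
  π_star (a : A) : IsAdjoint B (π a) (π (star a))
  F : carrier →L[ℂ] carrier
  F_adjointable : IsAdjointable B F
  compact_sq (a : A) : π a * (F * F - 1) ∈ compacts B carrier
  compact_commutator (a : A) : π a * F - F * π a ∈ compacts B carrier

attribute [instance] UngradedKasparovModule.instGroup UngradedKasparovModule.instSpace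
  UngradedKasparovModule.instAction UngradedKasparovModule.instHilbert
  UngradedKasparovModule.instComplete

/-- A Kasparov `A`-`B`-module for a graded C⋆-algebra `B` and a trivially graded `A`: a triple
`(E, π, F)` as before, where `E` is a graded Hilbert `B`-module, `π` has degree `0` and `F` has
degree `1`. The grading of `E` is given by its grading operator `γ`: the part of degree `i` is
`{x | γ x = (-1) ^ i • x}`. -/
structure KasparovModule (A : Type u) (B : Type v) [NonUnitalCStarAlgebra A]
    [NonUnitalCStarAlgebra B] [CStarGrading B] extends UngradedKasparovModule A B where
  γ : carrier →L[ℂ] carrier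
  γ_γ (x : carrier) : γ (γ x) = x
  γ_op_smul (x : carrier) (b : B) : γ (x <• b) = γ x <• gradeHom b
  inner_γ (x y : carrier) : ⟪γ x, γ y⟫_B = gradeHom ⟪x, y⟫_B
  π_even (a : A) (x : carrier) : π a (γ x) = γ (π a x)
  F_odd (x : carrier) : F (γ x) = -γ (F x)

section Homotopy

variable {A : Type u} {B C : Type v} [NonUnitalCStarAlgebra A] [NonUnitalCStarAlgebra B]
  [NonUnitalCStarAlgebra C]

/-- The map `(e, c) ↦ e ⊗ c`, here called `τ`, exhibits `y` as the pushforward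
`g_* x = (E ⊗_g C, π ⊗ 1, F ⊗ 1)` of `x = (E, π, F)` along `g : B → C`: the inner products are those
of the inner tensor product `E ⊗_g C`, the elements `τ e c` span a dense subspace, as they do in the
completion `E ⊗_g C`, and the operators act on the first factor. This determines `y` up to
unitary equivalence. -/
structure IsPushforward (g : B →⋆ₙₐ[ℂ] C) (x : UngradedKasparovModule A B)
    (y : UngradedKasparovModule A C) (τ : x.carrier → C → y.carrier) : Prop where
  inner_eq (e e' : x.carrier) (c c' : C) :
    ⟪τ e c, τ e' c'⟫_C = star c * (g ⟪e, e'⟫_B * c')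
  dense : (Submodule.span ℂ {z | ∃ e c, z = τ e c}).topologicalClosure = ⊤
  map_π (a : A) (e : x.carrier) (c : C) : τ (x.π a e) c = y.π a (τ e c)
  map_F (e : x.carrier) (c : C) : τ (x.F e) c = y.F (τ e c)

/-- Homotopy of ungraded Kasparov modules: there is an ungraded Kasparov `A`-`C([0, 1], B)`-module
`h` whose pushforwards along the evaluations at `0` and `1` are, up to unitary equivalence, `x` and
`y`. -/
def UngradedKasparovModule.Homotopic (x y : UngradedKasparovModule A B) : Prop :=
  ∃ h : UngradedKasparovModule A C(I, B),
    (∃ τ, IsPushforward (evalAt B 0) h x τ) ∧ ∃ τ, IsPushforward (evalAt B 1) h y τ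

/-- Homotopy of Kasparov modules over a graded C⋆-algebra. The unitary equivalences at the
end points preserve the gradings, `E ⊗_g C` being graded by `γ ⊗ α`. -/
def KasparovModule.Homotopic [CStarGrading B] (x y : KasparovModule A B) : Prop :=
  ∃ h : KasparovModule A C(I, B),
    (∃ τ, IsPushforward (evalAt B 0) h.toUngradedKasparovModule x.toUngradedKasparovModule τ ∧
      ∀ e b, τ (h.γ e) (gradeHom b) = x.γ (τ e b)) ∧
    ∃ τ, IsPushforward (evalAt B 1) h.toUngradedKasparovModule y.toUngradedKasparovModule τ ∧
      ∀ e b, τ (h.γ e) (gradeHom b) = y.γ (τ e b)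

end Homotopy

/-- The set of homotopy classes of ungraded Kasparov `A`-`B`-modules. (`Quot` divides by the
equivalence relation generated by homotopy; homotopy is in fact an equivalence relation.) -/
def UngradedKK (A : Type u) (B : Type v) [NonUnitalCStarAlgebra A] [NonUnitalCStarAlgebra B] :=
  Quot (UngradedKasparovModule.Homotopic (A := A) (B := B))

/-- `KK(A, B)`, the set of homotopy classes of Kasparov `A`-`B`-modules. -/
def KK (A : Type u) (B : Type v) [NonUnitalCStarAlgebra A] [NonUnitalCStarAlgebra B]
    [CStarGrading B] :=
  Quot (KasparovModule.Homotopic (A := A) (B := B))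

/-- The class of an ungraded Kasparov module. -/
def UngradedKK.mk {A : Type u} {B : Type v} [NonUnitalCStarAlgebra A] [NonUnitalCStarAlgebra B]
    (x : UngradedKasparovModule A B) : UngradedKK A B :=
  Quot.mk _ x

/-- The class of a Kasparov module. -/
def KK.mk {A : Type u} {B : Type v} [NonUnitalCStarAlgebra A] [NonUnitalCStarAlgebra B]
    [CStarGrading B] (x : KasparovModule A B) : KK A B :=
  Quot.mk _ x

/-! ### The module `E ⊗ C₁` -/

/-- The Hilbert `B ⊗ C₁`-module `E ⊗ C₁` (outer tensor product). The pair `(x, y)` stands for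
`x ⊗ 1 + y ⊗ ε`. -/
@[ext]
structure CliffordModule (E : Type*) where
  even : E
  odd : E

namespace CliffordModule

section Group

variable {E : Type*} [NormedAddCommGroup E] [NormedSpace ℂ E]

/-- The pair of components. -/
def toProd : CliffordModule E ≃ E × E where
  toFun x := (x.even, x.odd)
  invFun p := ⟨p.1, p.2⟩

instance : AddCommGroup (CliffordModule E) := toProd.addCommGroup
instance : Module ℂ (CliffordModule E) := toProd.module ℂ

@[simp] theorem even_zero : (0 : CliffordModule E).even = 0 := rfl
@[simp] theorem odd_zero : (0 : CliffordModule E).odd = 0 := rfl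
@[simp] theorem even_add (x y : CliffordModule E) : (x + y).even = x.even + y.even := rfl
@[simp] theorem odd_add (x y : CliffordModule E) : (x + y).odd = x.odd + y.odd := rfl
@[simp] theorem even_neg (x : CliffordModule E) : (-x).even = -x.even := rfl
@[simp] theorem odd_neg (x : CliffordModule E) : (-x).odd = -x.odd := rfl
@[simp] theorem even_sub (x y : CliffordModule E) : (x - y).even = x.even - y.even := rfl
@[simp] theorem odd_sub (x y : CliffordModule E) : (x - y).odd = x.odd - y.odd := rfl
@[simp] theorem even_smul (c : ℂ) (x : CliffordModule E) : (c • x).even = c • x.even := rfl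
@[simp] theorem odd_smul (c : ℂ) (x : CliffordModule E) : (c • x).odd = c • x.odd := rfl

/-- The linear map `x ⊗ 1 + y ⊗ ε ↦ (x + y, x - y)`. -/
def evalₗ : CliffordModule E →ₗ[ℂ] E × E where
  toFun x := (x.even + x.odd, x.even - x.odd)
  map_add' x y := by
    ext
    · change x.even + y.even + (x.odd + y.odd) = x.even + x.odd + (y.even + y.odd); abel
    · change x.even + y.even - (x.odd + y.odd) = x.even - x.odd + (y.even - y.odd); abel
  map_smul' c x := Prod.ext (smul_add c x.even x.odd).symm (smul_sub c x.even x.odd).symm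

theorem half_add_half (x : E) : (2⁻¹ : ℂ) • x + (2⁻¹ : ℂ) • x = x := by
  rw [← add_smul]; norm_num

theorem evalₗ_injective : Function.Injective (evalₗ (E := E)) := by
  rw [← LinearMap.ker_eq_bot, LinearMap.ker_eq_bot']
  intro x h
  have h1 : x.even + x.odd = 0 := congrArg Prod.fst h
  have h2 : x.even - x.odd = 0 := congrArg Prod.snd h
  have h3 : x.even = x.odd := sub_eq_zero.mp h2
  have h4 : x.odd = 0 := by
    rw [h3] at h1
    rw [← half_add_half x.odd, ← smul_add, h1, smul_zero]
  exact CliffordModule.ext (h3.trans h4) h4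

theorem evalₗ_surjective : Function.Surjective (evalₗ (E := E)) := by
  rintro ⟨p, q⟩
  refine ⟨⟨(2⁻¹ : ℂ) • (p + q), (2⁻¹ : ℂ) • (p - q)⟩, Prod.ext ?_ ?_⟩
  · calc (2⁻¹ : ℂ) • (p + q) + (2⁻¹ : ℂ) • (p - q) = (2⁻¹ : ℂ) • p + (2⁻¹ : ℂ) • p := by
          rw [smul_add, smul_sub]; abel
      _ = p := half_add_half p
  · calc (2⁻¹ : ℂ) • (p + q) - (2⁻¹ : ℂ) • (p - q) = (2⁻¹ : ℂ) • q + (2⁻¹ : ℂ) • q := by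
          rw [smul_add, smul_sub]; abel
      _ = q := half_add_half q

instance : NormedAddCommGroup (CliffordModule E) :=
  NormedAddCommGroup.induced (CliffordModule E) (E × E) evalₗ evalₗ_injective

instance : NormedSpace ℂ (CliffordModule E) := NormedSpace.induced ℂ (CliffordModule E) (E × E) evalₗ

theorem norm_def (x : CliffordModule E) : ‖x‖ = max ‖x.even + x.odd‖ ‖x.even - x.odd‖ := rfl

instance [CompleteSpace E] : CompleteSpace (CliffordModule E) := by
  have h : Isometry (evalₗ (E := E)) := AddMonoidHomClass.isometry_of_norm _ fun _ => rfl
  exact (h.isUniformInducing.completeSpace_congr evalₗ_surjective).mpr inferInstance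

theorem norm_even_le (x : CliffordModule E) : ‖x.even‖ ≤ ‖x‖ := by
  have h : x.even = (2⁻¹ : ℂ) • ((x.even + x.odd) + (x.even - x.odd)) := by
    rw [add_add_sub_cancel, smul_add, half_add_half]
  have h1 := norm_add_le (x.even + x.odd) (x.even - x.odd)
  have h2 : ‖x.even + x.odd‖ ≤ ‖x‖ := le_max_left _ _
  have h3 : ‖x.even - x.odd‖ ≤ ‖x‖ := le_max_right _ _
  rw [h, norm_smul, norm_inv, Complex.norm_ofNat]
  linarith

theorem norm_odd_le (x : CliffordModule E) : ‖x.odd‖ ≤ ‖x‖ := by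
  have h := norm_even_le (⟨x.odd, x.even⟩ : CliffordModule E)
  rwa [norm_def, norm_sub_rev, add_comm, ← norm_def] at h

/-- The component of degree `0`. -/
def evenL : CliffordModule E →L[ℂ] E :=
  LinearMap.mkContinuous ⟨⟨fun x => x.even, fun _ _ => rfl⟩, fun _ _ => rfl⟩ 1
    fun x => by rw [one_mul]; exact norm_even_le x

/-- The component of degree `1`. -/
def oddL : CliffordModule E →L[ℂ] E :=
  LinearMap.mkContinuous ⟨⟨fun x => x.odd, fun _ _ => rfl⟩, fun _ _ => rfl⟩ 1
    fun x => by rw [one_mul]; exact norm_odd_le x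

/-- The map `x ↦ x ⊗ 1`. -/
def tmulOne : E →L[ℂ] CliffordModule E :=
  LinearMap.mkContinuous ⟨⟨fun x => ⟨x, 0⟩, fun x y => CliffordModule.ext rfl (add_zero 0).symm⟩,
    fun c x => CliffordModule.ext rfl (smul_zero c).symm⟩ 1
    fun x => by simp [norm_def]

/-- The map `x ↦ x ⊗ ε`. -/
def tmulEps : E →L[ℂ] CliffordModule E :=
  LinearMap.mkContinuous ⟨⟨fun x => ⟨0, x⟩, fun x y => CliffordModule.ext (add_zero 0).symm rfl⟩,
    fun c x => CliffordModule.ext (smul_zero c).symm rfl⟩ 1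
    fun x => by simp [norm_def]

/-- The operator `T ⊗ 1`. -/
def mapOne (T : E →L[ℂ] E) : CliffordModule E →L[ℂ] CliffordModule E where
  toFun x := ⟨T x.even, T x.odd⟩
  map_add' _ _ := CliffordModule.ext (map_add T _ _) (map_add T _ _)
  map_smul' _ _ := CliffordModule.ext (map_smul T _ _) (map_smul T _ _)
  cont := (tmulOne ∘L T ∘L evenL + tmulEps ∘L T ∘L oddL).continuous.congr
    fun _ => CliffordModule.ext (add_zero _) (zero_add _)

/-- The operator `T ⊗ ε`. -/
def mapEps (T : E →L[ℂ] E) : CliffordModule E →L[ℂ] CliffordModule E where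
  toFun x := ⟨T x.odd, T x.even⟩
  map_add' _ _ := CliffordModule.ext (map_add T _ _) (map_add T _ _)
  map_smul' _ _ := CliffordModule.ext (map_smul T _ _) (map_smul T _ _)
  cont := (tmulOne ∘L T ∘L oddL + tmulEps ∘L T ∘L evenL).continuous.congr
    fun _ => CliffordModule.ext (add_zero _) (zero_add _)

/-- The grading operator of `E ⊗ C₁`. -/
def gradeL : CliffordModule E →L[ℂ] CliffordModule E where
  toFun x := ⟨x.even, -x.odd⟩
  map_add' _ _ := CliffordModule.ext rfl (neg_add _ _)
  map_smul' _ _ := CliffordModule.ext rfl (smul_neg _ _).symm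
  cont := (tmulOne ∘L evenL - tmulEps ∘L oddL).continuous.congr
    fun _ => CliffordModule.ext (sub_zero _) (zero_sub _)

/-- The compression `T ↦ j T p` of an operator, as a function of `T`. -/
def compress (p : CliffordModule E →L[ℂ] E) (j : E →L[ℂ] CliffordModule E) :
    (E →L[ℂ] E) →L[ℂ] (CliffordModule E →L[ℂ] CliffordModule E) :=
  (ContinuousLinearMap.compL ℂ (CliffordModule E) E (CliffordModule E) j) ∘L
    ((ContinuousLinearMap.compL ℂ (CliffordModule E) E E).flip p)

/-- `T ↦ T ⊗ 1` as a continuous linear map. -/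
def mapOneL : (E →L[ℂ] E) →L[ℂ] (CliffordModule E →L[ℂ] CliffordModule E) :=
  compress evenL tmulOne + compress oddL tmulEps

/-- `T ↦ T ⊗ ε` as a continuous linear map. -/
def mapEpsL : (E →L[ℂ] E) →L[ℂ] (CliffordModule E →L[ℂ] CliffordModule E) :=
  compress oddL tmulOne + compress evenL tmulEps

theorem mapOneL_apply (T : E →L[ℂ] E) : mapOneL T = mapOne T :=
  ContinuousLinearMap.ext fun _ => CliffordModule.ext (add_zero _) (zero_add _)

theorem mapEpsL_apply (T : E →L[ℂ] E) : mapEpsL T = mapEps T :=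
  ContinuousLinearMap.ext fun _ => CliffordModule.ext (add_zero _) (zero_add _)

@[simp] theorem evenL_apply (x : CliffordModule E) : evenL x = x.even := rfl
@[simp] theorem oddL_apply (x : CliffordModule E) : oddL x = x.odd := rfl
@[simp] theorem even_tmulOne (x : E) : (tmulOne x).even = x := rfl
@[simp] theorem odd_tmulOne (x : E) : (tmulOne x).odd = 0 := rfl
@[simp] theorem even_tmulEps (x : E) : (tmulEps x).even = 0 := rfl
@[simp] theorem odd_tmulEps (x : E) : (tmulEps x).odd = x := rfl

@[simp] theorem even_mapOne (T : E →L[ℂ] E) (x : CliffordModule E) :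
    (mapOne T x).even = T x.even := rfl
@[simp] theorem odd_mapOne (T : E →L[ℂ] E) (x : CliffordModule E) :
    (mapOne T x).odd = T x.odd := rfl
@[simp] theorem even_mapEps (T : E →L[ℂ] E) (x : CliffordModule E) :
    (mapEps T x).even = T x.odd := rfl
@[simp] theorem odd_mapEps (T : E →L[ℂ] E) (x : CliffordModule E) :
    (mapEps T x).odd = T x.even := rfl
@[simp] theorem even_gradeL (x : CliffordModule E) : (gradeL x).even = x.even := rfl
@[simp] theorem odd_gradeL (x : CliffordModule E) : (gradeL x).odd = -x.odd := rfl

end Group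

section Hilbert

variable {B E : Type*} [NonUnitalCStarAlgebra B] [NormedAddCommGroup E] [NormedSpace ℂ E]
  [SMul Bᵐᵒᵖ E] [HilbertModule B E]

instance : SMul (CliffordTensor B)ᵐᵒᵖ (CliffordModule E) :=
  ⟨fun b x => ⟨x.even <• b.unop.even + x.odd <• b.unop.odd,
    x.even <• b.unop.odd + x.odd <• b.unop.even⟩⟩

@[simp] theorem even_op_smul (x : CliffordModule E) (b : CliffordTensor B) :
    (x <• b).even = x.even <• b.even + x.odd <• b.odd := rfl
@[simp] theorem odd_op_smul (x : CliffordModule E) (b : CliffordTensor B) :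
    (x <• b).odd = x.even <• b.odd + x.odd <• b.even := rfl

instance : Inner (CliffordTensor B) (CliffordModule E) :=
  ⟨fun x y => ⟨⟪x.even, y.even⟫_B + ⟪x.odd, y.odd⟫_B, ⟪x.even, y.odd⟫_B + ⟪x.odd, y.even⟫_B⟩⟩

@[simp] theorem even_inner (x y : CliffordModule E) :
    (⟪x, y⟫_(CliffordTensor B)).even = ⟪x.even, y.even⟫_B + ⟪x.odd, y.odd⟫_B := rfl
@[simp] theorem odd_inner (x y : CliffordModule E) :
    (⟪x, y⟫_(CliffordTensor B)).odd = ⟪x.even, y.odd⟫_B + ⟪x.odd, y.even⟫_B := rfl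

theorem eval_inner (x y : CliffordModule E) :
    CliffordTensor.eval ⟪x, y⟫_(CliffordTensor B) =
      (⟪(evalₗ x).1, (evalₗ y).1⟫_B, ⟪(evalₗ x).2, (evalₗ y).2⟫_B) := by
  refine Prod.ext ?_ ?_
  · change ⟪x.even, y.even⟫_B + ⟪x.odd, y.odd⟫_B + (⟪x.even, y.odd⟫_B + ⟪x.odd, y.even⟫_B)
      = ⟪x.even + x.odd, y.even + y.odd⟫_B
    simp only [HilbertModule.inner_add_left, HilbertModule.inner_add_right]; abel
  · change ⟪x.even, y.even⟫_B + ⟪x.odd, y.odd⟫_B - (⟪x.even, y.odd⟫_B + ⟪x.odd, y.even⟫_B)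
      = ⟪x.even - x.odd, y.even - y.odd⟫_B
    simp only [HilbertModule.inner_sub_left, HilbertModule.inner_sub_right]; abel

instance : HilbertModule (CliffordTensor B) (CliffordModule E) where
  inner_add_right x y z := by
    ext <;> simp [-MulOpposite.op_add, -MulOpposite.op_neg, -MulOpposite.op_zero, HilbertModule.inner_add_right] <;> abel
  inner_smul_right c x y := by
    ext <;> simp [-MulOpposite.op_add, -MulOpposite.op_neg, -MulOpposite.op_zero, HilbertModule.inner_smul_right]
  inner_op_smul_right b x y := by
    ext <;> simp [-MulOpposite.op_add, -MulOpposite.op_neg, -MulOpposite.op_zero, HilbertModule.inner_add_right, HilbertModule.inner_op_smul_right, add_mul] <;> abel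
  star_inner x y := by
    ext <;> simp [-MulOpposite.op_add, -MulOpposite.op_neg, -MulOpposite.op_zero, HilbertModule.star_inner, add_comm]
  inner_self_pos x := by
    obtain ⟨b, hb⟩ := HilbertModule.inner_self_pos (B := B) (evalₗ x).1
    obtain ⟨c, hc⟩ := HilbertModule.inner_self_pos (B := B) (evalₗ x).2
    obtain ⟨d, hd⟩ := CliffordTensor.eval_surjective (b, c)
    refine ⟨d, CliffordTensor.eval_injective ?_⟩
    rw [eval_inner, CliffordTensor.eval_mul, CliffordTensor.eval_star, hd, hb, hc]
    rfl
  inner_self_eq_zero x h := by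
    have h1 := eval_inner (B := B) x x
    rw [h] at h1
    have h2 : CliffordTensor.eval (0 : CliffordTensor B) = 0 := map_zero CliffordTensor.evalHom
    rw [h2] at h1
    refine evalₗ_injective (Prod.ext ?_ ?_)
    · rw [map_zero]
      exact HilbertModule.inner_self_eq_zero (B := B) _ (congrArg Prod.fst h1).symm
    · rw [map_zero]
      exact HilbertModule.inner_self_eq_zero (B := B) _ (congrArg Prod.snd h1).symm
  norm_eq x := by
    refine (Real.sqrt_eq_iff_mul_self_eq (norm_nonneg _) (norm_nonneg _)).mpr ?_ |>.symm
    change ‖CliffordTensor.eval ⟪x, x⟫_(CliffordTensor B)‖ = _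
    rw [eval_inner, Prod.norm_def, ← HilbertModule.norm_sq_eq, ← HilbertModule.norm_sq_eq, ← sq]
    change _ = (max ‖(evalₗ x).1‖ ‖(evalₗ x).2‖) ^ 2
    rcases le_total ‖(evalₗ x).1‖ ‖(evalₗ x).2‖ with h | h
    · rw [max_eq_right h, max_eq_right (by gcongr)]
    · rw [max_eq_left h, max_eq_left (by gcongr)]

theorem mapOne_mem_compacts {T : E →L[ℂ] E} (hT : T ∈ compacts B E) :
    mapOne T ∈ compacts (CliffordTensor B) (CliffordModule E) := by
  rw [← mapOneL_apply]
  refine map_closure_le mapOneL (rankOne B E) _ ?_ hT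
  rintro S ⟨y, x, hS⟩
  rw [mapOneL_apply]
  refine Submodule.le_topologicalClosure _ (Submodule.subset_span ⟨tmulOne y, tmulOne x, ?_⟩)
  intro z
  ext <;> simp [-MulOpposite.op_add, -MulOpposite.op_zero, hS, HilbertModule.inner_zero_left,
    HilbertModule.zero_op_smul]

theorem mapEps_mem_compacts {T : E →L[ℂ] E} (hT : T ∈ compacts B E) :
    mapEps T ∈ compacts (CliffordTensor B) (CliffordModule E) := by
  rw [← mapEpsL_apply]
  refine map_closure_le mapEpsL (rankOne B E) _ ?_ hT
  rintro S ⟨y, x, hS⟩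
  rw [mapEpsL_apply]
  refine Submodule.le_topologicalClosure _ (Submodule.subset_span ⟨tmulEps y, tmulOne x, ?_⟩)
  intro z
  ext <;> simp [-MulOpposite.op_add, -MulOpposite.op_zero, hS, HilbertModule.inner_zero_left,
    HilbertModule.zero_op_smul]

theorem isCountablyGenerated (h : IsCountablyGenerated B E) :
    IsCountablyGenerated (CliffordTensor B) (CliffordModule E) := by
  obtain ⟨s, hs⟩ := h
  refine ⟨fun n => tmulOne (s n), eq_top_iff.mpr fun z _ => ?_⟩
  have h1 : tmulOne z.even ∈ (Submodule.span ℂ {x : CliffordModule E |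
      ∃ (n : ℕ) (b : CliffordTensor B), x = tmulOne (s n) <• b}).topologicalClosure := by
    refine map_closure_le tmulOne _ _ ?_ (hs.ge (Submodule.mem_top (x := z.even)))
    rintro x ⟨n, b, rfl⟩
    refine Submodule.le_topologicalClosure _ (Submodule.subset_span ⟨n, ⟨b, 0⟩, ?_⟩)
    ext <;> simp [-MulOpposite.op_add, -MulOpposite.op_neg, -MulOpposite.op_zero, HilbertModule.zero_op_smul, HilbertModule.op_smul_zero]
  have h2 : tmulEps z.odd ∈ (Submodule.span ℂ {x : CliffordModule E |
      ∃ (n : ℕ) (b : CliffordTensor B), x = tmulOne (s n) <• b}).topologicalClosure := by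
    refine map_closure_le tmulEps _ _ ?_ (hs.ge (Submodule.mem_top (x := z.odd)))
    rintro x ⟨n, b, rfl⟩
    refine Submodule.le_topologicalClosure _ (Submodule.subset_span ⟨n, ⟨0, b⟩, ?_⟩)
    ext <;> simp [-MulOpposite.op_add, -MulOpposite.op_neg, -MulOpposite.op_zero, HilbertModule.zero_op_smul, HilbertModule.op_smul_zero]
  have h3 : z = tmulOne z.even + tmulEps z.odd := by ext <;> simp
  rw [h3]
  exact add_mem h1 h2

end Hilbert

end CliffordModule

open CliffordModule in
/-- The map `(E, π, F) ↦ (E ⊗ C₁, π ⊗ 1, F ⊗ ε)` from ungraded Kasparov `A`-`B`-modules to Kasparov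
`A`-`B ⊗ C₁`-modules; `E ⊗ 1` has degree `0` and `E ⊗ ε` has degree `1`. -/
def UngradedKasparovModule.tensorClifford {A : Type u} {B : Type v} [NonUnitalCStarAlgebra A]
    [NonUnitalCStarAlgebra B] (x : UngradedKasparovModule A B) :
    KasparovModule A (CliffordTensor B) where
  carrier := CliffordModule x.carrier
  countablyGenerated := isCountablyGenerated x.countablyGenerated
  π :=
    { toFun := fun a => mapOne (x.π a)
      map_smul' := fun c a => by ext z <;> simp
      map_zero' := by ext z <;> simp
      map_add' := fun a b => by ext z <;> simp
      map_mul' := fun a b => by ext z <;> simp }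
  π_star a y z := by
    have h := x.π_star a
    ext <;> simp [h _ _]
  F := mapEps x.F
  F_adjointable := by
    obtain ⟨S, hS⟩ := x.F_adjointable
    refine ⟨mapEps S, fun y z => ?_⟩
    ext <;> simp [hS _ _, add_comm]
  compact_sq a := by
    convert mapOne_mem_compacts (x.compact_sq a) using 1
    ext z <;> simp
  compact_commutator a := by
    convert mapEps_mem_compacts (x.compact_commutator a) using 1
    ext z <;> simp
  γ := gradeL
  γ_γ y := by ext <;> simp
  γ_op_smul y b := by
    ext
    · simp [-MulOpposite.op_add, -MulOpposite.op_neg, -MulOpposite.op_zero, HilbertModule.op_smul_neg, HilbertModule.neg_op_smul]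
    · simp [-MulOpposite.op_add, -MulOpposite.op_neg, -MulOpposite.op_zero, HilbertModule.op_smul_neg, HilbertModule.neg_op_smul, add_comm]
  inner_γ y z := by
    ext <;> simp [-MulOpposite.op_add, -MulOpposite.op_neg, -MulOpposite.op_zero, HilbertModule.inner_neg_left, HilbertModule.inner_neg_right, add_comm]
  π_even a y := by ext <;> simp
  F_odd y := by ext <;> simp

/-! ### Direct sums -/

/-- The direct sum of two Hilbert `B`-modules. (`B` is a parameter since the norm depends on it.) -/
@[ext]
structure HSum (B E E' : Type*) where
  fst : E
  snd : E'

namespace HSum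

section Group

variable {B E E' : Type*} [AddCommGroup E] [Module ℂ E] [AddCommGroup E'] [Module ℂ E']

/-- The pair of components. -/
def toProd : HSum B E E' ≃ E × E' where
  toFun x := (x.fst, x.snd)
  invFun p := ⟨p.1, p.2⟩

instance : AddCommGroup (HSum B E E') := toProd.addCommGroup
instance : Module ℂ (HSum B E E') := toProd.module ℂ

@[simp] theorem fst_zero : (0 : HSum B E E').fst = 0 := rfl
@[simp] theorem snd_zero : (0 : HSum B E E').snd = 0 := rfl
@[simp] theorem fst_add (x y : HSum B E E') : (x + y).fst = x.fst + y.fst := rfl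
@[simp] theorem snd_add (x y : HSum B E E') : (x + y).snd = x.snd + y.snd := rfl
@[simp] theorem fst_neg (x : HSum B E E') : (-x).fst = -x.fst := rfl
@[simp] theorem snd_neg (x : HSum B E E') : (-x).snd = -x.snd := rfl
@[simp] theorem fst_sub (x y : HSum B E E') : (x - y).fst = x.fst - y.fst := rfl
@[simp] theorem snd_sub (x y : HSum B E E') : (x - y).snd = x.snd - y.snd := rfl
@[simp] theorem fst_smul (c : ℂ) (x : HSum B E E') : (c • x).fst = c • x.fst := rfl
@[simp] theorem snd_smul (c : ℂ) (x : HSum B E E') : (c • x).snd = c • x.snd := rfl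

end Group

section Action

variable {B E E' : Type*} [SMul Bᵐᵒᵖ E] [SMul Bᵐᵒᵖ E']

instance : SMul Bᵐᵒᵖ (HSum B E E') := ⟨fun b x => ⟨b • x.fst, b • x.snd⟩⟩

@[simp] theorem fst_op_smul (x : HSum B E E') (b : B) : (x <• b).fst = x.fst <• b := rfl
@[simp] theorem snd_op_smul (x : HSum B E E') (b : B) : (x <• b).snd = x.snd <• b := rfl

end Action

/-- The norm of a positive element is at most that of its sum with another one. -/
theorem norm_le_norm_add {B : Type*} [NonUnitalCStarAlgebra B] (a b : B) :
    ‖star a * a‖ ≤ ‖star a * a + star b * b‖ := by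
  let _ := CStarAlgebra.spectralOrder B
  have _ := CStarAlgebra.spectralOrderedRing B
  exact CStarAlgebra.norm_le_norm_of_nonneg_of_le (star_mul_self_nonneg a)
    (le_add_of_nonneg_right (star_mul_self_nonneg b))

/-- A sum of two positive elements is positive. -/
theorem exists_star_mul_self_add {B : Type*} [NonUnitalCStarAlgebra B] (a b : B) :
    ∃ c : B, star a * a + star b * b = star c * c := by
  let _ := CStarAlgebra.spectralOrder B
  have _ := CStarAlgebra.spectralOrderedRing B
  exact CStarAlgebra.nonneg_iff_eq_star_mul_self.mp
    (add_nonneg (star_mul_self_nonneg a) (star_mul_self_nonneg b))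

section Hilbert

variable {B E E' : Type*} [NonUnitalCStarAlgebra B] [NormedAddCommGroup E] [NormedSpace ℂ E]
  [SMul Bᵐᵒᵖ E] [HilbertModule B E] [NormedAddCommGroup E'] [NormedSpace ℂ E']
  [SMul Bᵐᵒᵖ E'] [HilbertModule B E']

instance : Norm (HSum B E E') := ⟨fun x => √‖⟪x.fst, x.fst⟫_B + ⟪x.snd, x.snd⟫_B‖⟩

instance : Inner B (HSum B E E') := ⟨fun x y => ⟪x.fst, y.fst⟫_B + ⟪x.snd, y.snd⟫_B⟩

theorem inner_def (x y : HSum B E E') : ⟪x, y⟫_B = ⟪x.fst, y.fst⟫_B + ⟪x.snd, y.snd⟫_B := rfl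

instance : HilbertModule B (HSum B E E') where
  inner_add_right x y z := by
    simp only [inner_def, fst_add, snd_add, HilbertModule.inner_add_right]; abel
  inner_smul_right c x y := by
    simp only [inner_def, fst_smul, snd_smul, HilbertModule.inner_smul_right, smul_add]
  inner_op_smul_right b x y := by
    simp only [inner_def, fst_op_smul, snd_op_smul, HilbertModule.inner_op_smul_right, add_mul]
  star_inner x y := by simp only [inner_def, star_add, HilbertModule.star_inner]
  inner_self_pos x := by
    obtain ⟨b, hb⟩ := HilbertModule.inner_self_pos (B := B) x.fst
    obtain ⟨c, hc⟩ := HilbertModule.inner_self_pos (B := B) x.snd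
    rw [inner_def, hb, hc]
    exact exists_star_mul_self_add b c
  inner_self_eq_zero x h := by
    obtain ⟨b, hb⟩ := HilbertModule.inner_self_pos (B := B) x.fst
    obtain ⟨c, hc⟩ := HilbertModule.inner_self_pos (B := B) x.snd
    have h1 := norm_le_norm_add b c
    have h2 := norm_le_norm_add c b
    rw [inner_def, hb, hc] at h
    rw [add_comm, h, norm_zero, norm_le_zero_iff, ← hc] at h2
    rw [h, norm_zero, norm_le_zero_iff, ← hb] at h1
    exact HSum.ext (HilbertModule.inner_self_eq_zero _ h1)
      (HilbertModule.inner_self_eq_zero _ h2)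
  norm_eq _ := rfl

instance : NormedAddCommGroup (HSum B E E') :=
  NormedAddCommGroup.ofCore (HilbertModule.normedSpaceCore B (HSum B E E'))

instance : NormedSpace ℂ (HSum B E E') :=
  NormedSpace.ofCore (HilbertModule.normedSpaceCore B (HSum B E E'))

theorem norm_fst_le (x : HSum B E E') : ‖x.fst‖ ≤ ‖x‖ := by
  rw [HilbertModule.norm_eq (B := B) x, HilbertModule.norm_eq (B := B) x.fst, inner_def]
  obtain ⟨b, hb⟩ := HilbertModule.inner_self_pos (B := B) x.fst
  obtain ⟨c, hc⟩ := HilbertModule.inner_self_pos (B := B) x.snd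
  rw [hb, hc]
  exact Real.sqrt_le_sqrt (norm_le_norm_add b c)

theorem norm_snd_le (x : HSum B E E') : ‖x.snd‖ ≤ ‖x‖ := by
  rw [HilbertModule.norm_eq (B := B) x, HilbertModule.norm_eq (B := B) x.snd, inner_def]
  obtain ⟨b, hb⟩ := HilbertModule.inner_self_pos (B := B) x.fst
  obtain ⟨c, hc⟩ := HilbertModule.inner_self_pos (B := B) x.snd
  rw [hb, hc, add_comm]
  exact Real.sqrt_le_sqrt (norm_le_norm_add c b)

theorem norm_mk_zero (x : E) : ‖(⟨x, 0⟩ : HSum B E E')‖ = ‖x‖ := by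
  rw [HilbertModule.norm_eq (B := B) x, HilbertModule.norm_eq (B := B), inner_def,
    HilbertModule.inner_zero_left, add_zero]

theorem norm_zero_mk (x : E') : ‖(⟨0, x⟩ : HSum B E E')‖ = ‖x‖ := by
  rw [HilbertModule.norm_eq (B := B) x, HilbertModule.norm_eq (B := B), inner_def,
    HilbertModule.inner_zero_left, zero_add]

/-- The first projection. -/
def fstL : HSum B E E' →L[ℂ] E :=
  LinearMap.mkContinuous ⟨⟨fun x => x.fst, fun _ _ => rfl⟩, fun _ _ => rfl⟩ 1
    fun x => by rw [one_mul]; exact norm_fst_le x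

/-- The second projection. -/
def sndL : HSum B E E' →L[ℂ] E' :=
  LinearMap.mkContinuous ⟨⟨fun x => x.snd, fun _ _ => rfl⟩, fun _ _ => rfl⟩ 1
    fun x => by rw [one_mul]; exact norm_snd_le x

/-- The first inclusion. -/
def inlL : E →L[ℂ] HSum B E E' :=
  LinearMap.mkContinuous ⟨⟨fun x => ⟨x, 0⟩, fun x y => HSum.ext rfl (add_zero 0).symm⟩,
    fun c x => HSum.ext rfl (smul_zero c).symm⟩ 1
    fun x => by rw [one_mul]; exact (norm_mk_zero x).le

/-- The second inclusion. -/
def inrL : E' →L[ℂ] HSum B E E' :=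
  LinearMap.mkContinuous ⟨⟨fun x => ⟨0, x⟩, fun x y => HSum.ext (add_zero 0).symm rfl⟩,
    fun c x => HSum.ext (smul_zero c).symm rfl⟩ 1
    fun x => by rw [one_mul]; exact (norm_zero_mk x).le

/-- The operator `T ⊕ S`. -/
def map (T : E →L[ℂ] E) (S : E' →L[ℂ] E') : HSum B E E' →L[ℂ] HSum B E E' where
  toFun x := ⟨T x.fst, S x.snd⟩
  map_add' x y := HSum.ext (map_add T _ _) (map_add S _ _)
  map_smul' c x := HSum.ext (map_smul T _ _) (map_smul S _ _)
  cont := by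
    have h := (inlL ∘L T ∘L fstL + inrL ∘L S ∘L sndL : HSum B E E' →L[ℂ] HSum B E E').continuous
    refine h.congr fun x => HSum.ext (add_zero _) (zero_add _)

theorem map_eq (T : E →L[ℂ] E) (S : E' →L[ℂ] E') :
    (map T S : HSum B E E' →L[ℂ] _) = inlL ∘L T ∘L fstL + inrL ∘L S ∘L sndL :=
  ContinuousLinearMap.ext fun _ => HSum.ext (add_zero _).symm (zero_add _).symm

@[simp] theorem fst_inlL (x : E) : (inlL x : HSum B E E').fst = x := rfl
@[simp] theorem snd_inlL (x : E) : (inlL x : HSum B E E').snd = 0 := rfl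
@[simp] theorem fst_inrL (x : E') : (inrL x : HSum B E E').fst = 0 := rfl
@[simp] theorem snd_inrL (x : E') : (inrL x : HSum B E E').snd = x := rfl
@[simp] theorem fstL_apply (x : HSum B E E') : fstL x = x.fst := rfl
@[simp] theorem sndL_apply (x : HSum B E E') : sndL x = x.snd := rfl
@[simp] theorem fst_map (T : E →L[ℂ] E) (S : E' →L[ℂ] E') (x : HSum B E E') :
    (map T S x).fst = T x.fst := rfl
@[simp] theorem snd_map (T : E →L[ℂ] E) (S : E' →L[ℂ] E') (x : HSum B E E') :
    (map T S x).snd = S x.snd := rfl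

instance [CompleteSpace E] [CompleteSpace E'] : CompleteSpace (HSum B E E') := by
  have h : IsUniformInducing fun x : HSum B E E' => (fstL.prod sndL) x := by
    refine AntilipschitzWith.isUniformInducing (K := 2) ?_
      (ContinuousLinearMap.uniformContinuous _)
    refine AddMonoidHomClass.antilipschitz_of_bound _ fun x => ?_
    have h1 : x = inlL x.fst + inrL x.snd := by ext <;> simp
    have h2 := norm_add_le (inlL x.fst : HSum B E E') (inrL x.snd)
    rw [← h1] at h2
    have h3 : ‖(inlL x.fst : HSum B E E')‖ = ‖x.fst‖ := norm_mk_zero _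
    have h4 : ‖(inrL x.snd : HSum B E E')‖ = ‖x.snd‖ := norm_zero_mk _
    have h5 : ‖x.fst‖ ≤ ‖(fstL.prod sndL) x‖ := le_max_left _ _
    have h6 : ‖x.snd‖ ≤ ‖(fstL.prod sndL) x‖ := le_max_right _ _
    rw [NNReal.coe_ofNat]
    linarith
  exact (h.completeSpace_congr fun p => ⟨⟨p.1, p.2⟩, rfl⟩).mpr inferInstance

theorem map_mem_compacts {T : E →L[ℂ] E} {S : E' →L[ℂ] E'} (hT : T ∈ compacts B E)
    (hS : S ∈ compacts B E') : (map T S : HSum B E E' →L[ℂ] _) ∈ compacts B (HSum B E E') := by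
  rw [map_eq]
  refine add_mem ?_ ?_
  · refine map_closure_le ((ContinuousLinearMap.compL ℂ (HSum B E E') E (HSum B E E') inlL) ∘L
      ((ContinuousLinearMap.compL ℂ (HSum B E E') E E).flip fstL)) (rankOne B E) _ ?_ hT
    rintro R ⟨y, x, hR⟩
    refine Submodule.le_topologicalClosure _ (Submodule.subset_span ⟨inlL y, inlL x, ?_⟩)
    intro z
    ext <;> simp [-MulOpposite.op_add, hR, inner_def, HilbertModule.inner_zero_left,
      HilbertModule.zero_op_smul]
  · refine map_closure_le ((ContinuousLinearMap.compL ℂ (HSum B E E') E' (HSum B E E') inrL) ∘L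
      ((ContinuousLinearMap.compL ℂ (HSum B E E') E' E').flip sndL)) (rankOne B E') _ ?_ hS
    rintro R ⟨y, x, hR⟩
    refine Submodule.le_topologicalClosure _ (Submodule.subset_span ⟨inrL y, inrL x, ?_⟩)
    intro z
    ext <;> simp [-MulOpposite.op_add, hR, inner_def, HilbertModule.inner_zero_left,
      HilbertModule.zero_op_smul]

theorem isCountablyGenerated (h : IsCountablyGenerated B E) (h' : IsCountablyGenerated B E') :
    IsCountablyGenerated B (HSum B E E') := by
  obtain ⟨s, hs⟩ := h
  obtain ⟨s', hs'⟩ := h'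
  obtain ⟨f, hf⟩ := exists_surjective_nat (ℕ ⊕ ℕ)
  refine ⟨fun n => Sum.elim (fun k => inlL (s k)) (fun k => inrL (s' k)) (f n),
    eq_top_iff.mpr fun z _ => ?_⟩
  have h3 : z = inlL z.fst + inrL z.snd := by ext <;> simp
  rw [h3]
  refine add_mem ?_ ?_
  · refine map_closure_le inlL _ _ ?_ (hs.ge (Submodule.mem_top (x := z.fst)))
    rintro x ⟨n, b, rfl⟩
    obtain ⟨k, hk⟩ := hf (Sum.inl n)
    refine Submodule.le_topologicalClosure _ (Submodule.subset_span ⟨k, b, ?_⟩)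
    simp only [hk, Sum.elim_inl, Sum.elim_inr]
    ext <;> simp [HilbertModule.zero_op_smul]
  · refine map_closure_le inrL _ _ ?_ (hs'.ge (Submodule.mem_top (x := z.snd)))
    rintro x ⟨n, b, rfl⟩
    obtain ⟨k, hk⟩ := hf (Sum.inr n)
    refine Submodule.le_topologicalClosure _ (Submodule.subset_span ⟨k, b, ?_⟩)
    simp only [hk, Sum.elim_inl, Sum.elim_inr]
    ext <;> simp [HilbertModule.zero_op_smul]

end Hilbert

end HSum

section Sum

variable {A : Type u} {B C : Type v} [NonUnitalCStarAlgebra A] [NonUnitalCStarAlgebra B]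
  [NonUnitalCStarAlgebra C]

/-- The sum `(E ⊕ E', π ⊕ π', F ⊕ F')` of ungraded Kasparov modules. -/
def UngradedKasparovModule.sum (x y : UngradedKasparovModule A B) :
    UngradedKasparovModule A B where
  carrier := HSum B x.carrier y.carrier
  countablyGenerated := HSum.isCountablyGenerated x.countablyGenerated y.countablyGenerated
  π :=
    { toFun := fun a => HSum.map (x.π a) (y.π a)
      map_smul' := fun c a => by ext z <;> simp
      map_zero' := by ext z <;> simp
      map_add' := fun a b => by ext z <;> simp
      map_mul' := fun a b => by ext z <;> simp }
  π_star a z w := by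
    have h := x.π_star a
    have h' := y.π_star a
    simp [HSum.inner_def, h _ _, h' _ _]
  F := HSum.map x.F y.F
  F_adjointable := by
    obtain ⟨S, hS⟩ := x.F_adjointable
    obtain ⟨S', hS'⟩ := y.F_adjointable
    refine ⟨HSum.map S S', fun z w => ?_⟩
    simp [HSum.inner_def, hS _ _, hS' _ _]
  compact_sq a := by
    convert HSum.map_mem_compacts (x.compact_sq a) (y.compact_sq a) using 1
    ext z <;> simp
  compact_commutator a := by
    convert HSum.map_mem_compacts (x.compact_commutator a) (y.compact_commutator a) using 1
    ext z <;> simp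

/-- The sum of Kasparov modules. -/
def KasparovModule.sum [CStarGrading B] (x y : KasparovModule A B) : KasparovModule A B where
  toUngradedKasparovModule := x.toUngradedKasparovModule.sum y.toUngradedKasparovModule
  γ := (HSum.map x.γ y.γ : HSum B x.carrier y.carrier →L[ℂ] HSum B x.carrier y.carrier)
  γ_γ _ := HSum.ext (x.γ_γ _) (y.γ_γ _)
  γ_op_smul _ b := HSum.ext (x.γ_op_smul _ b) (y.γ_op_smul _ b)
  inner_γ (z w : HSum B x.carrier y.carrier) := by
    change ⟪x.γ z.fst, x.γ w.fst⟫_B + ⟪y.γ z.snd, y.γ w.snd⟫_B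
      = gradeHom (⟪z.fst, w.fst⟫_B + ⟪z.snd, w.snd⟫_B)
    rw [x.inner_γ, y.inner_γ, map_add]
  π_even a _ := HSum.ext (x.π_even a _) (y.π_even a _)
  F_odd _ := HSum.ext (x.F_odd _) (y.F_odd _)

theorem IsPushforward.sum {g : B →⋆ₙₐ[ℂ] C} {x x' : UngradedKasparovModule A B}
    {y y' : UngradedKasparovModule A C} {τ : x.carrier → C → y.carrier}
    {τ' : x'.carrier → C → y'.carrier} (h : IsPushforward g x y τ)
    (h' : IsPushforward g x' y' τ') :
    IsPushforward g (x.sum x') (y.sum y')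
      (fun e c => (⟨τ e.fst c, τ' e.snd c⟩ : HSum C y.carrier y'.carrier)) where
  inner_eq e e' c c' := by
    change ⟪τ e.fst c, τ e'.fst c'⟫_C + ⟪τ' e.snd c, τ' e'.snd c'⟫_C
      = star c * (g (⟪e.fst, e'.fst⟫_B + ⟪e.snd, e'.snd⟫_B) * c')
    rw [h.inner_eq, h'.inner_eq, map_add, add_mul, mul_add]
  dense := by
    have h0 : ∀ c, τ 0 c = 0 := fun c => by
      refine HilbertModule.inner_self_eq_zero (B := C) _ ?_
      rw [h.inner_eq, HilbertModule.inner_zero_left, map_zero, zero_mul, mul_zero]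
    have h0' : ∀ c, τ' 0 c = 0 := fun c => by
      refine HilbertModule.inner_self_eq_zero (B := C) _ ?_
      rw [h'.inner_eq, HilbertModule.inner_zero_left, map_zero, zero_mul, mul_zero]
    suffices key : (Submodule.span ℂ {z : HSum C y.carrier y'.carrier |
        ∃ (e : HSum B x.carrier x'.carrier) (c : C), z = ⟨τ e.fst c, τ' e.snd c⟩}
        ).topologicalClosure = ⊤ from key
    refine eq_top_iff.mpr fun z _ => ?_
    have h3 : z = HSum.inlL z.fst + HSum.inrL z.snd := by ext <;> simp
    rw [h3]
    refine add_mem ?_ ?_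
    · refine map_closure_le HSum.inlL _ _ ?_ (h.dense.ge (Submodule.mem_top (x := z.fst)))
      rintro _ ⟨e, c, rfl⟩
      refine Submodule.le_topologicalClosure _ (Submodule.subset_span
        ⟨⟨e, 0⟩, c, ?_⟩)
      exact HSum.ext rfl (h0' c).symm
    · refine map_closure_le HSum.inrL _ _ ?_ (h'.dense.ge (Submodule.mem_top (x := z.snd)))
      rintro _ ⟨e, c, rfl⟩
      refine Submodule.le_topologicalClosure _ (Submodule.subset_span
        ⟨⟨0, e⟩, c, ?_⟩)
      exact HSum.ext (h0 c).symm rfl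
  map_π a e c := HSum.ext (h.map_π a e.fst c) (h'.map_π a e.snd c)
  map_F e c := HSum.ext (h.map_F e.fst c) (h'.map_F e.snd c)

theorem UngradedKasparovModule.Homotopic.sum {x x' y y' : UngradedKasparovModule A B}
    (h : x.Homotopic y) (h' : x'.Homotopic y') : (x.sum x').Homotopic (y.sum y') := by
  obtain ⟨k, ⟨_, h0⟩, ⟨_, h1⟩⟩ := h
  obtain ⟨k', ⟨_, h0'⟩, ⟨_, h1'⟩⟩ := h'
  exact ⟨k.sum k', ⟨_, h0.sum h0'⟩, ⟨_, h1.sum h1'⟩⟩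

theorem KasparovModule.Homotopic.sum [CStarGrading B] {x x' y y' : KasparovModule A B}
    (h : x.Homotopic y) (h' : x'.Homotopic y') : (x.sum x').Homotopic (y.sum y') := by
  obtain ⟨k, ⟨_, h0, g0⟩, ⟨_, h1, g1⟩⟩ := h
  obtain ⟨k', ⟨_, h0', g0'⟩, ⟨_, h1', g1'⟩⟩ := h'
  exact ⟨k.sum k', ⟨_, h0.sum h0', fun e b => HSum.ext (g0 e.fst b) (g0' e.snd b)⟩,
    ⟨_, h1.sum h1', fun e b => HSum.ext (g1 e.fst b) (g1' e.snd b)⟩⟩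

end Sum

/-! ### Constant homotopies and addition of homotopy classes -/

/-- If `t ↦ a t` is continuous with positive values, then `a` is positive in `C([0, 1], B)`. -/
theorem exists_continuous_star_mul_self {B : Type*} [NonUnitalCStarAlgebra B] (a : C(I, B))
    (ha : ∀ t, ∃ b, a t = star b * b) : ∃ b : C(I, B), a = star b * b := by
  let _ := CStarAlgebra.spectralOrder B
  have _ := CStarAlgebra.spectralOrderedRing B
  have h0 : ∀ t, 0 ≤ a t := fun t => CStarAlgebra.nonneg_iff_eq_star_mul_self.mpr (ha t)
  have hc : Continuous fun t => CFC.sqrt (a t) :=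
    CFC.continuousOn_sqrt.comp_continuous a.continuous h0
  refine ⟨⟨fun t => CFC.sqrt (a t), hc⟩, ?_⟩
  ext t
  change a t = star (CFC.sqrt (a t)) * CFC.sqrt (a t)
  rw [(IsSelfAdjoint.of_nonneg (CFC.sqrt_nonneg (a t))).star_eq, CFC.sqrt_mul_sqrt_self _ (h0 t)]

namespace ConstHomotopy

variable {B E : Type*} [NonUnitalCStarAlgebra B] [NormedAddCommGroup E] [NormedSpace ℂ E]
  [SMul Bᵐᵒᵖ E] [HilbertModule B E]

instance : SMul C(I, B)ᵐᵒᵖ C(I, E) :=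
  ⟨fun b f => ⟨fun t => f t <• b.unop t,
    HilbertModule.continuous_op_smul f.continuous b.unop.continuous⟩⟩

@[simp] theorem op_smul_apply (f : C(I, E)) (b : C(I, B)) (t : I) : (f <• b) t = f t <• b t := rfl

instance : Inner C(I, B) C(I, E) :=
  ⟨fun f g => ⟨fun t => ⟪f t, g t⟫_B, HilbertModule.continuous_inner f.continuous g.continuous⟩⟩

@[simp] theorem inner_apply (f g : C(I, E)) (t : I) : ⟪f, g⟫_C(I, B) t = ⟪f t, g t⟫_B := rfl

instance : HilbertModule C(I, B) C(I, E) where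
  inner_add_right f g h := ContinuousMap.ext fun _ => HilbertModule.inner_add_right _ _ _
  inner_smul_right c f g := ContinuousMap.ext fun _ => HilbertModule.inner_smul_right _ _ _
  inner_op_smul_right b f g :=
    ContinuousMap.ext fun t => HilbertModule.inner_op_smul_right (b t) (f t) (g t)
  star_inner f g := ContinuousMap.ext fun _ => HilbertModule.star_inner _ _
  inner_self_pos f := exists_continuous_star_mul_self _ fun t => HilbertModule.inner_self_pos (f t)
  inner_self_eq_zero f h :=
    ContinuousMap.ext fun t => HilbertModule.inner_self_eq_zero (B := B) _ (DFunLike.congr_fun h t)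
  norm_eq f := by
    refine le_antisymm ?_ ?_
    · refine (ContinuousMap.norm_le _ (Real.sqrt_nonneg _)).mpr fun t => ?_
      rw [HilbertModule.norm_eq (B := B)]
      exact Real.sqrt_le_sqrt (ContinuousMap.norm_coe_le_norm ⟪f, f⟫_C(I, B) t)
    · refine Real.sqrt_le_iff.mpr ⟨norm_nonneg _, ?_⟩
      refine (ContinuousMap.norm_le _ (sq_nonneg _)).mpr fun t => ?_
      rw [inner_apply, ← HilbertModule.norm_sq_eq]
      have := ContinuousMap.norm_coe_le_norm f t
      gcongr

/-- Bounded operators, with the topology of `E` coming from its norm. -/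
abbrev Op (E : Type*) [NormedAddCommGroup E] [NormedSpace ℂ E] := E →L[ℂ] E

/-- The operator on `C([0, 1], E)` given by the constant family `T`. -/
def constMap (T : E →L[ℂ] E) : Op C(I, E) :=
  LinearMap.mkContinuous
    { toFun := fun f => ⟨fun t => T (f t), by fun_prop⟩
      map_add' := fun f g => ContinuousMap.ext fun t => map_add T (f t) (g t)
      map_smul' := fun c f => ContinuousMap.ext fun t => map_smul T c (f t) } ‖T‖ fun f => by
    refine (ContinuousMap.norm_le _ (by positivity)).mpr fun t => ?_
    refine (T.le_opNorm (f t)).trans ?_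
    have := ContinuousMap.norm_coe_le_norm f t
    gcongr

theorem norm_constMap_le (T : E →L[ℂ] E) : ‖constMap T‖ ≤ ‖T‖ :=
  LinearMap.mkContinuous_norm_le _ (norm_nonneg T) _

/-- `constMap` as a linear map. -/
def constMapₗ : Op E →ₗ[ℂ] Op C(I, E) where
  toFun := constMap
  map_add' _ _ := rfl
  map_smul' _ _ := rfl

/-- `constMap` as a continuous linear map. -/
def mapL : Op E →L[ℂ] Op C(I, E) :=
  LinearMap.mkContinuous (constMapₗ (E := E)) 1 fun T : E →L[ℂ] E =>
    (norm_constMap_le T).trans_eq (one_mul ‖T‖).symm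

@[simp] theorem mapL_apply (T : E →L[ℂ] E) (f : C(I, E)) (t : I) : mapL T f t = T (f t) := rfl

theorem mapL_mem_compacts {T : E →L[ℂ] E} (hT : T ∈ compacts B E) :
    mapL T ∈ compacts C(I, B) C(I, E) := by
  refine map_closure_le mapL (rankOne B E) _ ?_ hT
  rintro S ⟨y, x, hS⟩
  exact Submodule.le_topologicalClosure _ (Submodule.subset_span
    ⟨ContinuousMap.const I y, ContinuousMap.const I x, fun f => ContinuousMap.ext fun t => hS (f t)⟩)

/-- The functions `t ↦ φ t • x`, as a function of `x`. -/
def smulConst (φ : C(I, ℝ)) : E →L[ℂ] C(I, E) :=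
  LinearMap.mkContinuous
    { toFun := fun x => ⟨fun t => φ t • x, by fun_prop⟩
      map_add' := fun x y => ContinuousMap.ext fun t => smul_add (φ t) x y
      map_smul' := fun c x => ContinuousMap.ext fun t => smul_comm (φ t) c x } ‖φ‖ fun x => by
    refine (ContinuousMap.norm_le _ (by positivity)).mpr fun t => ?_
    change ‖φ t • x‖ ≤ _
    rw [norm_smul]
    have := ContinuousMap.norm_coe_le_norm φ t
    gcongr

theorem isCountablyGenerated (h : IsCountablyGenerated B E) :
    IsCountablyGenerated C(I, B) C(I, E) := by
  obtain ⟨s, hs⟩ := h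
  refine ⟨fun n => ContinuousMap.const I (s n), eq_top_iff.mpr fun f _ => ?_⟩
  refine (Submodule.isClosed_topologicalClosure _).mem_of_tendsto
    (bernsteinApproximation_uniform f) (Filter.Eventually.of_forall fun n => ?_)
  refine Submodule.sum_mem _ fun k _ => ?_
  refine map_closure_le (smulConst (bernstein n k)) _ _ ?_
    (hs.ge (Submodule.mem_top (x := f (bernstein.z k))))
  rintro x ⟨m, b, rfl⟩
  refine Submodule.le_topologicalClosure _ (Submodule.subset_span
    ⟨m, smulConst (bernstein n k) b, ContinuousMap.ext fun t => ?_⟩)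
  change (bernstein n k t : ℝ) • (s m <• b) = s m <• ((bernstein n k t : ℝ) • b)
  rw [← Complex.coe_smul, ← Complex.coe_smul, HilbertModule.op_smul_smul]

end ConstHomotopy

section Refl

variable {A : Type u} {B : Type v} [NonUnitalCStarAlgebra A] [NonUnitalCStarAlgebra B]

/-- The constant homotopy `(C([0, 1], E), π, F)`. -/
def UngradedKasparovModule.const (x : UngradedKasparovModule A B) :
    UngradedKasparovModule A C(I, B) where
  carrier := C(I, x.carrier)
  countablyGenerated := ConstHomotopy.isCountablyGenerated x.countablyGenerated
  π :=
    { toFun := fun a => ConstHomotopy.mapL (x.π a)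
      map_smul' := fun c a => by ext f t; simp
      map_zero' := by ext f t; simp
      map_add' := fun a b => by ext f t; simp
      map_mul' := fun a b => by ext f t; simp }
  π_star a f g := ContinuousMap.ext fun t => x.π_star a (f t) (g t)
  F := ConstHomotopy.mapL x.F
  F_adjointable := by
    obtain ⟨S, hS⟩ := x.F_adjointable
    exact ⟨ConstHomotopy.mapL S, fun f g => ContinuousMap.ext fun t => hS (f t) (g t)⟩
  compact_sq a := ConstHomotopy.mapL_mem_compacts (x.compact_sq a)
  compact_commutator a := ConstHomotopy.mapL_mem_compacts (x.compact_commutator a)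

/-- The constant homotopy of Kasparov modules. -/
def KasparovModule.const [CStarGrading B] (x : KasparovModule A B) : KasparovModule A C(I, B) where
  toUngradedKasparovModule := x.toUngradedKasparovModule.const
  γ := (ConstHomotopy.mapL x.γ : ConstHomotopy.Op C(I, x.carrier))
  γ_γ (f : C(I, x.carrier)) := ContinuousMap.ext fun t => x.γ_γ (f t)
  γ_op_smul (f : C(I, x.carrier)) b := ContinuousMap.ext fun t => x.γ_op_smul (f t) (b t)
  inner_γ (f g : C(I, x.carrier)) := ContinuousMap.ext fun t => x.inner_γ (f t) (g t)
  π_even a (f : C(I, x.carrier)) := ContinuousMap.ext fun t => x.π_even a (f t)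
  F_odd (f : C(I, x.carrier)) := ContinuousMap.ext fun t => x.F_odd (f t)

/-- The map `(f, b) ↦ f t <• b`. -/
def UngradedKasparovModule.constEval (x : UngradedKasparovModule A B) (t : I)
    (f : C(I, x.carrier)) (b : B) : x.carrier :=
  f t <• b

theorem UngradedKasparovModule.const_isPushforward (x : UngradedKasparovModule A B) (t : I) :
    IsPushforward (evalAt B t) x.const x (x.constEval t) where
  inner_eq (f g : C(I, x.carrier)) b c := by
    change ⟪f t <• b, g t <• c⟫_B = star b * (⟪f t, g t⟫_B * c)
    rw [HilbertModule.inner_op_smul_left, HilbertModule.inner_op_smul_right]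
  dense := by
    obtain ⟨s, hs⟩ := x.countablyGenerated
    refine top_le_iff.mp (hs.ge.trans (Submodule.topologicalClosure_mono (Submodule.span_mono ?_)))
    rintro _ ⟨n, b, rfl⟩
    exact ⟨ContinuousMap.const I (s n), b, rfl⟩
  map_π a (f : C(I, x.carrier)) b := HilbertModule.ext_inner B fun z => by
    change ⟪z, x.π a (f t) <• b⟫_B = ⟪z, x.π a (f t <• b)⟫_B
    have h := x.π_star (star a)
    rw [star_star] at h
    rw [← h, HilbertModule.inner_op_smul_right, HilbertModule.inner_op_smul_right, h]
  map_F (f : C(I, x.carrier)) b := HilbertModule.ext_inner B fun z => by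
    change ⟪z, x.F (f t) <• b⟫_B = ⟪z, x.F (f t <• b)⟫_B
    obtain ⟨S, hS⟩ := x.F_adjointable
    have h : ∀ u v, ⟪S u, v⟫_B = ⟪u, x.F v⟫_B := fun u v => by
      rw [← HilbertModule.star_inner, ← hS, HilbertModule.star_inner]
    rw [← h, HilbertModule.inner_op_smul_right, HilbertModule.inner_op_smul_right, h]

theorem UngradedKasparovModule.Homotopic.refl (x : UngradedKasparovModule A B) : x.Homotopic x :=
  ⟨x.const, ⟨_, x.const_isPushforward 0⟩, ⟨_, x.const_isPushforward 1⟩⟩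

theorem KasparovModule.Homotopic.refl [CStarGrading B] (x : KasparovModule A B) :
    x.Homotopic x :=
  ⟨x.const,
    ⟨_, x.const_isPushforward 0, fun (f : C(I, x.carrier)) b => (x.γ_op_smul (f 0) b).symm⟩,
    ⟨_, x.const_isPushforward 1, fun (f : C(I, x.carrier)) b => (x.γ_op_smul (f 1) b).symm⟩⟩

/-- The addition of homotopy classes induced by the direct sum. -/
instance : Add (UngradedKK A B) :=
  ⟨Quot.map₂ UngradedKasparovModule.sum
    (fun x _ _ h => (UngradedKasparovModule.Homotopic.refl x).sum h)
    (fun _ _ y h => h.sum (UngradedKasparovModule.Homotopic.refl y))⟩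

/-- The addition of homotopy classes induced by the direct sum. -/
instance [CStarGrading B] : Add (KK A B) :=
  ⟨Quot.map₂ KasparovModule.sum
    (fun x _ _ h => (KasparovModule.Homotopic.refl x).sum h)
    (fun _ _ y h => h.sum (KasparovModule.Homotopic.refl y))⟩

theorem UngradedKK.mk_add_mk (x y : UngradedKasparovModule A B) :
    UngradedKK.mk x + UngradedKK.mk y = UngradedKK.mk (x.sum y) := rfl

theorem KK.mk_add_mk [CStarGrading B] (x y : KasparovModule A B) :
    KK.mk x + KK.mk y = KK.mk (x.sum y) := rfl

end Refl

end

end KKTheory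

/-! The element `1 ⊗ ε` is a central, self-adjoint, unitary multiplier of `B ⊗ C₁` of degree one. It
therefore acts by right multiplication on every Hilbert `B ⊗ C₁`-module `E`. On a graded module this
operator `eps` is isometric, squares to one and anticommutes with the grading operator, so it
identifies the part `E₀` of degree zero with the part of degree one. Hence `E = E₀ ⊕ E₀ ε ≅ E₀ ⊗
C₁`. Inner products of vectors of degree zero lie in `B ⊗ 1`, which makes `E₀` a Hilbert `B`-module.

Every adjointable operator commutes with `eps` and is thus linear over `C₁`. An even one has the
form `T ⊗ 1`. An odd one such as `F` has the form `F₀ ⊗ ε`, where `F₀` is the restriction of `ε F`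
to `E₀`. So `(E, π, F)` comes from the ungraded triple `(E₀, π, ε F)` (`KasparovModule.evenPart`),
and the two constructions are inverse to each other up to unitary equivalence:
`isUnitaryEquiv_ofEvenPart` and `isUnitaryEquiv_toEvenPart`. Compactness passes to the even part by
`compr_mem_compacts`.

Both constructions commute with pushforward along `g` and `g ⊗ 1` (`IsPushforward.tensorClifford`,
`IsPushforward.evenPart`). Through the identification `C([0, 1], B) ⊗ C₁ ≅ C([0, 1], B ⊗ C₁)` they
therefore carry homotopies to homotopies. Unitarily equivalent modules are homotopic by a constant
homotopy, so the induced maps on classes are mutually inverse. Additivity is the unitary equivalence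
`(E ⊕ E') ⊗ C₁ ≅ (E ⊗ C₁) ⊕ (E' ⊗ C₁)`. -/

namespace KKTheory

open MulOpposite
open scoped RightActions unitInterval InnerProductSpace

noncomputable section

universe u v

open CStarGrading

/-! ### Algebra of `B ⊗ C₁`: the multiplier `1 ⊗ ε`, the copy `B ⊗ 1`, functoriality in `B`. -/

namespace CliffordTensor

variable {B C : Type*} [NonUnitalCStarAlgebra B] [NonUnitalCStarAlgebra C]

/-- Multiplication by `1 ⊗ ε`. -/
def swap : CliffordTensor B →ₗ[ℂ] CliffordTensor B where
  toFun d := ⟨d.odd, d.even⟩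
  map_add' _ _ := rfl
  map_smul' _ _ := rfl

@[simp] theorem even_swap (d : CliffordTensor B) : (swap d).even = d.odd := rfl
@[simp] theorem odd_swap (d : CliffordTensor B) : (swap d).odd = d.even := rfl

theorem swap_swap (d : CliffordTensor B) : swap (swap d) = d := rfl

theorem star_swap (d : CliffordTensor B) : star (swap d) = swap (star d) := rfl

theorem mul_swap (d e : CliffordTensor B) : d * swap e = swap (d * e) := rfl

/-- Together with `mul_swap` this says that the multiplier `1 ⊗ ε` is central: the tensor product
with `C₁` is the ungraded one, as `B` is trivially graded. -/
theorem swap_mul (d e : CliffordTensor B) : swap d * e = swap (d * e) := by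
  ext <;> simp [add_comm]

theorem gradeHom_swap (d : CliffordTensor B) : gradeHom (swap d) = -swap (gradeHom d) :=
  CliffordTensor.ext (neg_neg d.odd).symm rfl

theorem norm_swap (d : CliffordTensor B) : ‖swap d‖ = ‖d‖ := by
  rw [norm_def, norm_def, even_swap, odd_swap, add_comm, norm_sub_rev]

theorem continuous_swap : Continuous (swap (B := B)) :=
  AddMonoidHomClass.continuous_of_bound (swap (B := B)) 1 fun d => by rw [one_mul, norm_swap]

/-- The inclusion `b ↦ b ⊗ 1`. -/
def ofEven (b : B) : CliffordTensor B := ⟨b, 0⟩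

@[simp] theorem even_ofEven (b : B) : (ofEven b).even = b := rfl
@[simp] theorem odd_ofEven (b : B) : (ofEven b).odd = 0 := rfl

theorem ofEven_mul (b c : B) : ofEven (b * c) = ofEven b * ofEven c := by ext <;> simp

theorem norm_ofEven (b : B) : ‖ofEven b‖ = ‖b‖ := by simp [norm_def]

theorem gradeHom_ofEven (b : B) : gradeHom (ofEven b) = ofEven b := by ext <;> simp

theorem eq_ofEven_add_swap (d : CliffordTensor B) :
    d = ofEven d.even + swap (ofEven d.odd) := by ext <;> simp

@[simp] theorem even_neg (d : CliffordTensor B) : (-d).even = -d.even := rfl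
@[simp] theorem odd_neg (d : CliffordTensor B) : (-d).odd = -d.odd := rfl

/-- The odd component equals its own negative, hence vanishes since 2 is invertible. -/
theorem eq_ofEven_of_gradeHom_eq {d : CliffordTensor B} (h : gradeHom d = d) :
    d = ofEven d.even := by
  have h1 : -d.odd = d.odd := congrArg odd h
  refine CliffordTensor.ext rfl ?_
  rw [odd_ofEven, ← CliffordModule.half_add_half d.odd]
  nth_rw 1 [← h1]
  rw [smul_neg, neg_add_cancel]

/-- The ⋆-homomorphism `g ⊗ 1`. -/
def mapHom (g : B →⋆ₙₐ[ℂ] C) : CliffordTensor B →⋆ₙₐ[ℂ] CliffordTensor C where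
  toFun d := ⟨g d.even, g d.odd⟩
  map_smul' c d := CliffordTensor.ext (map_smul g c _) (map_smul g c _)
  map_zero' := CliffordTensor.ext (map_zero g) (map_zero g)
  map_add' d e := CliffordTensor.ext (map_add g _ _) (map_add g _ _)
  map_mul' d e := by ext <;> simp
  map_star' d := CliffordTensor.ext (map_star g _) (map_star g _)

@[simp] theorem even_mapHom (g : B →⋆ₙₐ[ℂ] C) (d : CliffordTensor B) :
    (mapHom g d).even = g d.even := rfl
@[simp] theorem odd_mapHom (g : B →⋆ₙₐ[ℂ] C) (d : CliffordTensor B) :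
    (mapHom g d).odd = g d.odd := rfl

theorem mapHom_swap (g : B →⋆ₙₐ[ℂ] C) (d : CliffordTensor B) :
    mapHom g (swap d) = swap (mapHom g d) := rfl

/-- The norms of `CliffordTensor B` and `CliffordModule B` are given by the same formula, so the
estimate for modules applies verbatim. -/
theorem norm_even_le (d : CliffordTensor B) : ‖d.even‖ ≤ ‖d‖ :=
  CliffordModule.norm_even_le (⟨d.even, d.odd⟩ : CliffordModule B)

theorem norm_odd_le (d : CliffordTensor B) : ‖d.odd‖ ≤ ‖d‖ :=
  CliffordModule.norm_odd_le (⟨d.even, d.odd⟩ : CliffordModule B)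

/-- The component of degree `0` as a linear map. -/
def evenₗ : CliffordTensor B →ₗ[ℂ] B := ⟨⟨even, fun _ _ => rfl⟩, fun _ _ => rfl⟩

/-- The component of degree `1` as a linear map. -/
def oddₗ : CliffordTensor B →ₗ[ℂ] B := ⟨⟨odd, fun _ _ => rfl⟩, fun _ _ => rfl⟩

theorem continuous_even : Continuous (even : CliffordTensor B → B) :=
  AddMonoidHomClass.continuous_of_bound (evenₗ (B := B)) 1 fun d =>
    (norm_even_le d).trans_eq (one_mul _).symm

theorem continuous_odd : Continuous (odd : CliffordTensor B → B) :=
  AddMonoidHomClass.continuous_of_bound (oddₗ (B := B)) 1 fun d =>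
    (norm_odd_le d).trans_eq (one_mul _).symm

/-- The isomorphism `C([0, 1], B) ⊗ C₁ ≅ C([0, 1], B ⊗ C₁)`. -/
def continuousMapEquiv : CliffordTensor C(I, B) ≃⋆ₐ[ℂ] C(I, CliffordTensor B) where
  toFun f := ⟨fun t => ⟨f.even t, f.odd t⟩,
    isometry_eval.isUniformInducing.isInducing.continuous_iff.mpr ((f.even.continuous.add
      f.odd.continuous).prodMk (f.even.continuous.sub f.odd.continuous))⟩
  invFun f := ⟨⟨fun t => (f t).even, continuous_even.comp f.continuous⟩,
    ⟨fun t => (f t).odd, continuous_odd.comp f.continuous⟩⟩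
  left_inv _ := rfl
  right_inv _ := rfl
  map_mul' _ _ := rfl
  map_add' _ _ := rfl
  map_star' _ := rfl
  map_smul' _ _ := rfl

theorem continuousMapEquiv_gradeHom (f : CliffordTensor C(I, B)) :
    continuousMapEquiv (gradeHom f) = gradeHom (continuousMapEquiv f) := rfl

end CliffordTensor

/-! ### Transport along isomorphisms of coefficient algebras -/

section Congr

/-- The Hilbert module `E` over `B`, regarded as a module over the isomorphic algebra `C`. -/
abbrev HilbertModule.congr {B C E : Type*} [NonUnitalCStarAlgebra B] [NonUnitalCStarAlgebra C]
    [AddCommGroup E] [Module ℂ E] [SMul Bᵐᵒᵖ E] [Norm E] [HilbertModule B E] (φ : B ≃⋆ₐ[ℂ] C) :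
    let _ : SMul Cᵐᵒᵖ E := ⟨fun c x => x <• φ.symm c.unop⟩
    HilbertModule C E :=
  let _ : SMul Cᵐᵒᵖ E := ⟨fun c x => x <• φ.symm c.unop⟩
  { inner := fun x y => φ ⟪x, y⟫_B
    inner_add_right := fun x y z => by rw [HilbertModule.inner_add_right, map_add]
    inner_smul_right := fun c x y => by rw [HilbertModule.inner_smul_right, map_smul]
    inner_op_smul_right := fun c x y => by
      change φ ⟪x, y <• φ.symm c⟫_B = _
      rw [HilbertModule.inner_op_smul_right, map_mul, StarAlgEquiv.apply_symm_apply]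
    star_inner := fun x y => by rw [← map_star, HilbertModule.star_inner]
    inner_self_pos := fun x => by
      obtain ⟨b, hb⟩ := HilbertModule.inner_self_pos (B := B) x
      exact ⟨φ b, by rw [hb, map_mul, map_star]⟩
    inner_self_eq_zero := fun x h =>
      HilbertModule.inner_self_eq_zero (B := B) x ((map_eq_zero_iff φ φ.injective).mp h)
    norm_eq := fun x => by
      rw [HilbertModule.norm_eq (B := B) x]
      congr 1
      exact (NonUnitalStarAlgHom.norm_map φ φ.injective _).symm }

variable {A : Type u} {B C D : Type v} [NonUnitalCStarAlgebra A] [NonUnitalCStarAlgebra B]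
  [NonUnitalCStarAlgebra C] [NonUnitalCStarAlgebra D]

/-- The Kasparov module `(E, π, F)` over the isomorphic algebra `C`. -/
def UngradedKasparovModule.congr (φ : B ≃⋆ₐ[ℂ] C) (x : UngradedKasparovModule A B) :
    UngradedKasparovModule A C :=
  let iS : SMul Cᵐᵒᵖ x.carrier := ⟨fun c y => y <• φ.symm c.unop⟩
  let iH : HilbertModule C x.carrier := HilbertModule.congr (B := B) φ
  -- The rank one operators stay the same: `φ` in the inner product cancels against `φ.symm` in the
  -- action.
  have hc {T : x.carrier →L[ℂ] x.carrier} (hT : T ∈ compacts B x.carrier) :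
      T ∈ compacts C x.carrier := by
    refine Submodule.topologicalClosure_mono (Submodule.span_mono ?_) hT
    rintro S ⟨y, z, hS⟩
    refine ⟨y, z, fun w => (hS w).trans ?_⟩
    change _ = y <• φ.symm (φ ⟪z, w⟫_B)
    rw [StarAlgEquiv.symm_apply_apply]
  { carrier := x.carrier
    instAction := iS
    instHilbert := iH
    countablyGenerated := by
      obtain ⟨s, hs⟩ := x.countablyGenerated
      refine ⟨s, top_le_iff.mp (hs.ge.trans (Submodule.topologicalClosure_mono
        (Submodule.span_mono ?_)))⟩
      rintro _ ⟨n, b, rfl⟩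
      refine ⟨n, φ b, ?_⟩
      change _ = s n <• φ.symm (φ b)
      rw [StarAlgEquiv.symm_apply_apply]
    π := x.π
    π_star := fun a y z => congrArg φ (x.π_star a y z)
    F := x.F
    F_adjointable := by
      obtain ⟨S, hS⟩ := x.F_adjointable
      exact ⟨S, fun y z => congrArg φ (hS y z)⟩
    compact_sq := fun a => hc (x.compact_sq a)
    compact_commutator := fun a => hc (x.compact_commutator a) }

/-- The graded Kasparov module `(E, π, F)` over the isomorphic algebra `C`. -/
def KasparovModule.congr [CStarGrading B] [CStarGrading C] (φ : B ≃⋆ₐ[ℂ] C)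
    (hφ : ∀ b, φ (gradeHom b) = gradeHom (φ b)) (x : KasparovModule A B) :
    KasparovModule A C where
  toUngradedKasparovModule := x.toUngradedKasparovModule.congr φ
  γ := x.γ
  γ_γ := x.γ_γ
  γ_op_smul (y : x.carrier) c := by
    change x.γ (y <• φ.symm c) = x.γ y <• φ.symm (gradeHom c)
    rw [x.γ_op_smul]
    congr 2
    rw [← StarAlgEquiv.symm_apply_apply φ (gradeHom _), hφ, StarAlgEquiv.apply_symm_apply]
  inner_γ (y z : x.carrier) := by
    change φ ⟪x.γ y, x.γ z⟫_B = gradeHom (φ ⟪y, z⟫_B)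
    rw [x.inner_γ, hφ]
  π_even := x.π_even
  F_odd := x.F_odd

/-- Used to pass between evaluation on `C([0, 1], B ⊗ C₁)` and `g ⊗ 1` for `g` the evaluation on
`C([0, 1], B)`; the same `τ` serves for both. -/
theorem IsPushforward.congr {g : B →⋆ₙₐ[ℂ] D} {x : UngradedKasparovModule A B}
    {y : UngradedKasparovModule A D} {τ : x.carrier → D → y.carrier} (h : IsPushforward g x y τ)
    (φ : B ≃⋆ₐ[ℂ] C) {g' : C →⋆ₙₐ[ℂ] D} (hg : ∀ b, g' (φ b) = g b) :
    IsPushforward g' (x.congr φ) y τ where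
  inner_eq (e e' : x.carrier) c c' := by
    change _ = star c * (g' (φ ⟪e, e'⟫_B) * c')
    rw [hg, h.inner_eq]
  dense := h.dense
  map_π := h.map_π
  map_F := h.map_F

end Congr

/-! ### Unitary equivalence -/

section Unitary

variable {A : Type u} {B C : Type v} [NonUnitalCStarAlgebra A] [NonUnitalCStarAlgebra B]
  [NonUnitalCStarAlgebra C]

/-- `V` is a unitary equivalence of ungraded Kasparov modules. -/
structure IsUnitaryEquiv (x y : UngradedKasparovModule A B) (V : x.carrier →L[ℂ] y.carrier) :
    Prop where
  inner_map (e e' : x.carrier) : ⟪V e, V e'⟫_B = ⟪e, e'⟫_B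
  surjective : Function.Surjective V
  map_π (a : A) (e : x.carrier) : V (x.π a e) = y.π a (V e)
  map_F (e : x.carrier) : V (x.F e) = y.F (V e)

theorem IsPushforward.comp_unitary {g : B →⋆ₙₐ[ℂ] C} {x : UngradedKasparovModule A B}
    {y z : UngradedKasparovModule A C} {τ : x.carrier → C → y.carrier}
    (h : IsPushforward g x y τ) {V : y.carrier →L[ℂ] z.carrier} (hV : IsUnitaryEquiv y z V) :
    IsPushforward g x z fun e c => V (τ e c) where
  inner_eq e e' c c' := by rw [hV.inner_map, h.inner_eq]
  dense := by
    refine eq_top_iff.mpr fun w _ => ?_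
    obtain ⟨w, rfl⟩ := hV.surjective w
    refine map_closure_le V _ _ ?_ (h.dense.ge (Submodule.mem_top (x := w)))
    rintro _ ⟨e, c, rfl⟩
    exact Submodule.le_topologicalClosure _ (Submodule.subset_span ⟨e, c, rfl⟩)
  map_π a e c := by rw [h.map_π, hV.map_π]
  map_F e c := by rw [h.map_F, hV.map_F]

/-- Pushforwards are only determined up to unitary equivalence, so the constant homotopy of `x` also
ends at `y`. -/
theorem IsUnitaryEquiv.homotopic {x y : UngradedKasparovModule A B}
    {V : x.carrier →L[ℂ] y.carrier} (hV : IsUnitaryEquiv x y V) : x.Homotopic y :=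
  ⟨x.const, ⟨_, x.const_isPushforward 0⟩, ⟨_, (x.const_isPushforward 1).comp_unitary hV⟩⟩

theorem IsUnitaryEquiv.homotopic_graded [CStarGrading B] {x y : KasparovModule A B}
    {V : x.carrier →L[ℂ] y.carrier}
    (hV : IsUnitaryEquiv x.toUngradedKasparovModule y.toUngradedKasparovModule V)
    (hγ : ∀ e, V (x.γ e) = y.γ (V e)) : x.Homotopic y :=
  ⟨x.const,
    ⟨_, x.const_isPushforward 0, fun (f : C(I, x.carrier)) b => (x.γ_op_smul (f 0) b).symm⟩,
    ⟨_, (x.const_isPushforward 1).comp_unitary hV, fun (f : C(I, x.carrier)) b => by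
      rw [← hγ]
      exact congrArg V (x.γ_op_smul (f 1) b).symm⟩⟩

end Unitary

/-! ### Right multiplication by `1 ⊗ ε` -/

section Epsilon

open CliffordTensor

variable {B E : Type*} [NonUnitalCStarAlgebra B] [NormedAddCommGroup E] [NormedSpace ℂ E]
  [SMul (CliffordTensor B)ᵐᵒᵖ E] [HilbertModule (CliffordTensor B) E]

/-- The hypothesis characterises `y` as `x ε`. The two factors `ε` in `⟪x ε, x ε⟫` cancel, so `x ↦ x
ε` preserves norms wherever it is defined. -/
theorem inner_self_of_inner_eq_swap {x y : E}
    (h : ∀ z : E, ⟪z, y⟫_(CliffordTensor B) = swap ⟪z, x⟫_(CliffordTensor B)) :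
    ⟪y, y⟫_(CliffordTensor B) = ⟪x, x⟫_(CliffordTensor B) := by
  rw [h y, ← HilbertModule.star_inner x y, h x, star_swap, HilbertModule.star_inner, swap_swap]

variable (B E) in
/-- The vectors on which right multiplication by `1 ⊗ ε` is defined. -/
def epsDomain : Submodule ℂ E where
  carrier := {x | ∃ y : E, ∀ z : E, ⟪z, y⟫_(CliffordTensor B) = swap ⟪z, x⟫_(CliffordTensor B)}
  add_mem' := by
    rintro x x' ⟨y, hy⟩ ⟨y', hy'⟩
    exact ⟨y + y', fun z => by
      rw [HilbertModule.inner_add_right, HilbertModule.inner_add_right, hy, hy', map_add]⟩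
  zero_mem' := ⟨0, fun z => by rw [HilbertModule.inner_zero_right, map_zero]⟩
  smul_mem' := by
    rintro c x ⟨y, hy⟩
    exact ⟨c • y, fun z => by
      rw [HilbertModule.inner_smul_right, HilbertModule.inner_smul_right, hy, map_smul]⟩

/-- As `x ↦ x ε` is isometric, it sends a convergent sequence to a Cauchy sequence. The limit has
the required inner products by continuity. -/
theorem isClosed_epsDomain [CompleteSpace E] : IsClosed (epsDomain B E : Set E) := by
  refine isClosed_of_closure_subset fun x hx => ?_
  obtain ⟨u, hu, hux⟩ := mem_closure_iff_seq_limit.mp hx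
  choose w hw using hu
  have hdist : ∀ m n, dist (w m) (w n) = dist (u m) (u n) := fun m n => by
    rw [dist_eq_norm, dist_eq_norm, HilbertModule.norm_eq (B := CliffordTensor B),
      HilbertModule.norm_eq (B := CliffordTensor B) (u m - u n)]
    rw [inner_self_of_inner_eq_swap fun z => ?_]
    rw [HilbertModule.inner_sub_right, HilbertModule.inner_sub_right, hw, hw, map_sub]
  have hc : CauchySeq w := by
    rw [Metric.cauchySeq_iff']
    simpa only [hdist] using Metric.cauchySeq_iff'.mp hux.cauchySeq
  obtain ⟨y, hy⟩ := cauchySeq_tendsto_of_complete hc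
  refine ⟨y, fun z => ?_⟩
  have hcont : Continuous fun e : E => ⟪z, e⟫_(CliffordTensor B) :=
    HilbertModule.continuous_inner continuous_const continuous_id
  refine tendsto_nhds_unique ((hcont.tendsto y).comp hy) ?_
  refine (((continuous_swap.comp hcont).tendsto x).comp hux).congr fun n => ?_
  exact (hw n z).symm

/-- If `B` has no unit, `1 ⊗ ε` is only a multiplier of `B ⊗ C₁`, so its action has to be
constructed. On `s n <• b` it is `s n <• (b ε)`; these vectors span a dense subspace and the domain
is closed. Countable generation enters only through this density. -/
theorem exists_eps [CompleteSpace E] (h : IsCountablyGenerated (CliffordTensor B) E) (x : E) :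
    ∃ y : E, ∀ z : E, ⟪z, y⟫_(CliffordTensor B) = swap ⟪z, x⟫_(CliffordTensor B) := by
  obtain ⟨s, hs⟩ := h
  have h1 : (⊤ : Submodule ℂ E) ≤ epsDomain B E := by
    rw [← hs]
    refine Submodule.topologicalClosure_minimal _ (Submodule.span_le.mpr ?_) isClosed_epsDomain
    rintro _ ⟨n, b, rfl⟩
    refine ⟨s n <• swap b, fun z => ?_⟩
    rw [HilbertModule.inner_op_smul_right, HilbertModule.inner_op_smul_right, mul_swap]
  exact h1 (Submodule.mem_top (x := x))

variable [CompleteSpace E] (h : IsCountablyGenerated (CliffordTensor B) E)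

/-- Right multiplication by `1 ⊗ ε`. -/
def eps : E →L[ℂ] E :=
  LinearMap.mkContinuous
    { toFun := fun x => (exists_eps h x).choose
      map_add' := fun x y => HilbertModule.ext_inner (CliffordTensor B) fun z => by
        rw [HilbertModule.inner_add_right, (exists_eps h _).choose_spec,
          (exists_eps h _).choose_spec, (exists_eps h _).choose_spec,
          HilbertModule.inner_add_right, map_add]
      map_smul' := fun c x => HilbertModule.ext_inner (CliffordTensor B) fun z => by
        rw [HilbertModule.inner_smul_right, (exists_eps h _).choose_spec,
          (exists_eps h _).choose_spec, HilbertModule.inner_smul_right, map_smul]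
        rfl } 1 fun x => by
    change ‖(exists_eps h x).choose‖ ≤ _
    rw [one_mul, HilbertModule.norm_eq (B := CliffordTensor B),
      inner_self_of_inner_eq_swap (exists_eps h x).choose_spec, ← HilbertModule.norm_eq]

theorem inner_eps (z x : E) :
    ⟪z, eps h x⟫_(CliffordTensor B) = swap ⟪z, x⟫_(CliffordTensor B) :=
  (exists_eps h x).choose_spec z

theorem eps_inner (x z : E) :
    ⟪eps h x, z⟫_(CliffordTensor B) = swap ⟪x, z⟫_(CliffordTensor B) := by
  rw [← HilbertModule.star_inner, inner_eps, star_swap, HilbertModule.star_inner]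

theorem eps_eq {x y : E}
    (hy : ∀ z : E, ⟪z, y⟫_(CliffordTensor B) = swap ⟪z, x⟫_(CliffordTensor B)) : eps h x = y :=
  HilbertModule.ext_inner (CliffordTensor B) fun z => by rw [inner_eps, hy]

theorem eps_eps (x : E) : eps h (eps h x) = x :=
  eps_eq h fun z => by rw [inner_eps, swap_swap]

theorem eps_op_smul (x : E) (b : CliffordTensor B) : eps h (x <• b) = eps h x <• b :=
  eps_eq h fun z => by
    rw [HilbertModule.inner_op_smul_right, HilbertModule.inner_op_smul_right, inner_eps, swap_mul]

/-- Moves `ε` from the coefficient to the vector, so that odd coefficients can be replaced by even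
ones. -/
theorem op_smul_swap (x : E) (b : CliffordTensor B) : x <• swap b = eps h x <• b :=
  HilbertModule.ext_inner (CliffordTensor B) fun z => by
    rw [HilbertModule.inner_op_smul_right, HilbertModule.inner_op_smul_right, inner_eps, swap_mul,
      mul_swap]

/-- An operator that is an adjoint is linear over multipliers too: moving it to the other side of
the inner product leaves `ε` free to come out. -/
theorem eps_comm_of_isAdjoint {T S : E →L[ℂ] E} (hT : IsAdjoint (CliffordTensor B) S T) (x : E) :
    eps h (T x) = T (eps h x) :=
  eps_eq h fun z => by rw [← hT, inner_eps, hT]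

theorem IsAdjoint.symm {B E : Type*} [NonUnitalCStarAlgebra B] [NormedAddCommGroup E]
    [NormedSpace ℂ E] [SMul Bᵐᵒᵖ E] [HilbertModule B E] {T S : E →L[ℂ] E}
    (hT : IsAdjoint B T S) : IsAdjoint B S T := fun x y => by
  rw [← HilbertModule.star_inner, ← hT, HilbertModule.star_inner]

/-- On generators, `ε θ y x = θ (y ε) x`. -/
theorem eps_mul_mem_compacts {T : E →L[ℂ] E} (hT : T ∈ compacts (CliffordTensor B) E) :
    eps h * T ∈ compacts (CliffordTensor B) E := by
  refine map_closure_le (ContinuousLinearMap.mul ℂ (E →L[ℂ] E) (eps h)) _ _ ?_ hT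
  rintro S ⟨y, x, hS⟩
  refine Submodule.le_topologicalClosure _ (Submodule.subset_span ⟨eps h y, x, fun z => ?_⟩)
  change eps h (S z) = _
  rw [hS, eps_op_smul]

end Epsilon

/-! ### The even part of a Kasparov module over `B ⊗ C₁` -/

section EvenPart

open CliffordTensor

variable {A : Type u} {B : Type v} [NonUnitalCStarAlgebra A] [NonUnitalCStarAlgebra B]

namespace KasparovModule

variable (x : KasparovModule A (CliffordTensor B))

/-- Right multiplication by `1 ⊗ ε` on a Kasparov module. -/
abbrev ε : x.carrier →L[ℂ] x.carrier := eps x.countablyGenerated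

/-- The sign is that of `gradeHom_swap`: `ε` has degree one, so it exchanges the even and odd parts
of the module. -/
theorem γ_ε (e : x.carrier) : x.γ (x.ε e) = -x.ε (x.γ e) :=
  HilbertModule.ext_inner (CliffordTensor B) fun z => by
    rw [← x.γ_γ z, x.inner_γ, inner_eps, gradeHom_swap, ← x.inner_γ,
      HilbertModule.inner_neg_right, inner_eps]

/-- The vectors of degree `0`. -/
def evenSubmodule : Submodule ℂ x.carrier where
  carrier := {e | x.γ e = e}
  add_mem' {e f} he hf := by
    change x.γ (e + f) = e + f
    rw [map_add, he, hf]
  zero_mem' := map_zero x.γ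
  smul_mem' c e he := by
    change x.γ (c • e) = c • e
    rw [map_smul, he]

theorem isClosed_evenSubmodule : IsClosed (x.evenSubmodule : Set x.carrier) :=
  isClosed_eq x.γ.continuous continuous_id

instance : CompleteSpace x.evenSubmodule := x.isClosed_evenSubmodule.completeSpace_coe

instance : SMul Bᵐᵒᵖ x.evenSubmodule :=
  ⟨fun b e => ⟨e.1 <• ofEven b.unop, by
    change x.γ _ = _
    rw [x.γ_op_smul, gradeHom_ofEven, e.2]⟩⟩

theorem coe_op_smul (e : x.evenSubmodule) (b : B) :
    ((e <• b : x.evenSubmodule) : x.carrier) = e.1 <• ofEven b := rfl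

instance : Inner B x.evenSubmodule := ⟨fun e f => (⟪e.1, f.1⟫_(CliffordTensor B)).even⟩

theorem inner_def (e f : x.evenSubmodule) :
    ⟪e, f⟫_B = (⟪e.1, f.1⟫_(CliffordTensor B)).even := rfl

/-- The grading fixes the inner product of two vectors that `γ` fixes. Hence no information is lost
in the definition of the `B`-valued form by even components. -/
theorem inner_coe (e f : x.evenSubmodule) :
    ⟪e.1, f.1⟫_(CliffordTensor B) = ofEven ⟪e, f⟫_B :=
  eq_ofEven_of_gradeHom_eq (by rw [← x.inner_γ, e.2, f.2])

instance : HilbertModule B x.evenSubmodule where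
  inner_add_right e f g := congrArg even (HilbertModule.inner_add_right e.1 f.1 g.1)
  inner_smul_right c e f := congrArg even (HilbertModule.inner_smul_right c e.1 f.1)
  inner_op_smul_right b e f := by
    rw [inner_def, coe_op_smul, HilbertModule.inner_op_smul_right, inner_coe, ← ofEven_mul,
      even_ofEven]
  star_inner e f := congrArg even (HilbertModule.star_inner e.1 f.1)
  inner_self_pos e := by
    -- The even component of `d⋆ d` is a sum of two positive elements, one for each component of
    -- `d`.
    obtain ⟨d, hd⟩ := HilbertModule.inner_self_pos (B := CliffordTensor B) e.1
    rw [inner_def, hd]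
    exact HSum.exists_star_mul_self_add d.even d.odd
  inner_self_eq_zero e h := by
    refine Subtype.ext (HilbertModule.inner_self_eq_zero (B := CliffordTensor B) e.1 ?_)
    rw [inner_coe, h]
    rfl
  norm_eq e := by
    rw [Submodule.coe_norm, HilbertModule.norm_eq (B := CliffordTensor B) e.1, inner_coe,
      norm_ofEven]

/-- The projection onto the vectors of degree `0`. -/
def evenProj : x.carrier →L[ℂ] x.evenSubmodule :=
  ((2⁻¹ : ℂ) • (1 + x.γ)).codRestrict x.evenSubmodule fun e => by
    change x.γ ((2⁻¹ : ℂ) • (e + x.γ e)) = (2⁻¹ : ℂ) • (e + x.γ e)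
    rw [map_smul, map_add, x.γ_γ, add_comm]

theorem coe_evenProj (e : x.carrier) : (x.evenProj e : x.carrier) = (2⁻¹ : ℂ) • (e + x.γ e) := rfl

theorem evenProj_of_mem {e : x.carrier} (he : x.γ e = e) : (x.evenProj e : x.carrier) = e := by
  rw [coe_evenProj, he, smul_add, CliffordModule.half_add_half]

theorem evenProj_coe (e : x.evenSubmodule) : x.evenProj e = e :=
  Subtype.ext (x.evenProj_of_mem e.2)

/-- The decomposition `E = E₀ ⊕ E₀ ε`. Since `γ` and `ε` anticommute, the second summand is `(e - γ
e) / 2`, the odd part of `e`. -/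
theorem eq_evenProj_add (e : x.carrier) :
    e = x.evenProj e + x.ε (x.evenProj (x.ε e) : x.carrier) := by
  rw [coe_evenProj, coe_evenProj, x.γ_ε, map_smul, map_add, map_neg, eps_eps, eps_eps,
    ← smul_add, add_add_add_comm, add_neg_cancel, add_zero, smul_add, CliffordModule.half_add_half]

theorem evenProj_op_smul (e : x.carrier) (b : B) :
    x.evenProj (e <• ofEven b) = x.evenProj e <• b :=
  Subtype.ext <| by
    rw [coe_evenProj, coe_op_smul, coe_evenProj, x.γ_op_smul, gradeHom_ofEven,
      HilbertModule.smul_op_smul, HilbertModule.add_op_smul]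

/-- The projection is adjoint to the inclusion, once the form is cut down to its even component. -/
theorem inner_evenProj (e : x.carrier) (f : x.evenSubmodule) :
    ⟪x.evenProj e, f⟫_B = (⟪e, f.1⟫_(CliffordTensor B)).even := by
  have h : ⟪x.γ e, f.1⟫_(CliffordTensor B) = gradeHom ⟪e, f.1⟫_(CliffordTensor B) := by
    rw [← x.inner_γ, f.2]
  rw [inner_def, coe_evenProj, HilbertModule.inner_smul_left, HilbertModule.inner_add_left, h,
    even_smul, even_add, gradeHom_even, star_inv₀, star_ofNat, smul_add,
    CliffordModule.half_add_half]

/-- The compression of an operator to the vectors of degree `0`. -/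
def compr : ConstHomotopy.Op x.carrier →L[ℂ] ConstHomotopy.Op x.evenSubmodule :=
  (ContinuousLinearMap.compL ℂ x.evenSubmodule x.carrier x.evenSubmodule x.evenProj) ∘L
    ((ContinuousLinearMap.compL ℂ x.evenSubmodule x.carrier x.carrier).flip
      x.evenSubmodule.subtypeL)

theorem compr_apply (T : x.carrier →L[ℂ] x.carrier) (e : x.evenSubmodule) :
    x.compr T e = x.evenProj (T e) := rfl

theorem coe_compr {T : x.carrier →L[ℂ] x.carrier} (hT : ∀ e, T (x.γ e) = x.γ (T e))
    (e : x.evenSubmodule) : (x.compr T e : x.carrier) = T e :=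
  x.evenProj_of_mem <| by
    change x.γ (T e) = T e
    rw [← hT, e.2]

/-- Write `P` for `evenProj`. For `e` of degree zero, the components of `⟪w, e⟫` are `⟪P w, e⟫` and
`⟪P (w ε), e⟫`. Hence the compression of `θ y w` is `θ (P y) (P w) + θ (P (y ε)) (P (w ε))`, a sum
of two rank one operators over `B`. -/
theorem compr_mem_compacts {T : x.carrier →L[ℂ] x.carrier}
    (hT : T ∈ compacts (CliffordTensor B) x.carrier) : x.compr T ∈ compacts B x.evenSubmodule := by
  refine map_closure_le x.compr (rankOne (CliffordTensor B) x.carrier) _ ?_ hT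
  rintro S ⟨y, w, hS⟩
  -- Membership in `rankOne` presupposes a bounded operator with the given values; it is composed
  -- from the continuous form and the continuous action.
  have key : ∀ y w : x.carrier, ∃ R ∈ rankOne B x.evenSubmodule,
      ∀ e, R e = x.evenProj y <• ⟪x.evenProj w, e⟫_B := fun y w =>
    ⟨(HilbertModule.actionL B x.evenSubmodule (x.evenProj y)) ∘L
      (HilbertModule.innerL B x.evenSubmodule (x.evenProj w)), ⟨_, _, fun e => rfl⟩, fun e => rfl⟩
  obtain ⟨R, hR, hR'⟩ := key y w
  obtain ⟨Q, hQ, hQ'⟩ := key (x.ε y) (x.ε w)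
  have h : x.compr S = R + Q := by
    ext1 e
    rw [add_apply, hR', hQ', inner_evenProj, inner_evenProj, compr_apply, hS,
      eps_inner, even_swap, ← evenProj_op_smul, ← evenProj_op_smul,
      ← op_smul_swap, ← map_add, ← HilbertModule.op_smul_add, ← eq_ofEven_add_swap]
  rw [h]
  exact Submodule.le_topologicalClosure _
    (add_mem (Submodule.subset_span hR) (Submodule.subset_span hQ))

theorem isCountablyGenerated_evenSubmodule : IsCountablyGenerated B x.evenSubmodule := by
  obtain ⟨s, hs⟩ := x.countablyGenerated
  obtain ⟨f, hf⟩ := exists_surjective_nat (ℕ ⊕ ℕ)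
  -- Generators of either degree contribute: the even part of `s n <• b` combines those of `s n` and
  -- `s n ε`, with the even and odd components of `b` as coefficients.
  refine ⟨fun n => Sum.elim (fun k => x.evenProj (s k)) (fun k => x.evenProj (x.ε (s k))) (f n),
    eq_top_iff.mpr fun e _ => ?_⟩
  rw [← x.evenProj_coe e]
  refine map_closure_le x.evenProj _ _ ?_ (hs.ge (Submodule.mem_top (x := e.1)))
  rintro _ ⟨n, b, rfl⟩
  obtain ⟨k, hk⟩ := hf (Sum.inl n)
  obtain ⟨l, hl⟩ := hf (Sum.inr n)
  refine Submodule.le_topologicalClosure _ ?_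
  rw [eq_ofEven_add_swap b, HilbertModule.op_smul_add, op_smul_swap x.countablyGenerated, map_add,
    evenProj_op_smul, evenProj_op_smul]
  exact add_mem (Submodule.subset_span ⟨k, b.even, by simp only [hk, Sum.elim_inl]⟩)
    (Submodule.subset_span ⟨l, b.odd, by simp only [hl, Sum.elim_inr]⟩)

theorem ε_π (a : A) (e : x.carrier) : x.ε (x.π a e) = x.π a (x.ε e) :=
  eps_comm_of_isAdjoint _ (x.π_star a).symm e

theorem ε_F (e : x.carrier) : x.ε (x.F e) = x.F (x.ε e) := by
  obtain ⟨S, hS⟩ := x.F_adjointable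
  exact eps_comm_of_isAdjoint _ hS.symm e

/-- Two odd operators compose to an even one, so `ε F` restricts to the vectors of degree zero,
which `F` alone does not preserve. -/
theorem εF_γ (e : x.carrier) : (x.ε * x.F) (x.γ e) = x.γ ((x.ε * x.F) e) := by
  change x.ε (x.F (x.γ e)) = x.γ (x.ε (x.F e))
  rw [x.F_odd, x.γ_ε, map_neg]

theorem isAdjoint_compr {T S : x.carrier →L[ℂ] x.carrier}
    (h : IsAdjoint (CliffordTensor B) T S) : IsAdjoint B (x.compr T) (x.compr S) := fun e f => by
  rw [compr_apply, compr_apply, inner_evenProj, h, ← HilbertModule.star_inner,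
    ← HilbertModule.star_inner _ e, inner_evenProj]
  rfl

/-- The ungraded Kasparov `A`-`B`-module `(E₀, π, F ε)` of a Kasparov `A`-`B ⊗ C₁`-module
`(E, π, F)`, where `E₀` is the part of degree `0` of `E`. -/
def evenPart : UngradedKasparovModule A B where
  carrier := x.evenSubmodule
  countablyGenerated := x.isCountablyGenerated_evenSubmodule
  π :=
    { toFun := fun a => x.compr (x.π a)
      map_smul' := fun c a => by rw [map_smul, map_smul]; rfl
      map_zero' := by rw [map_zero, map_zero]
      map_add' := fun a b => by rw [map_add, map_add]
      map_mul' := fun a b => by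
        ext1 e
        change x.compr (x.π (a * b)) e = x.compr (x.π a) (x.compr (x.π b) e)
        rw [compr_apply, compr_apply, x.coe_compr (x.π_even b), map_mul]
        rfl }
  π_star a := x.isAdjoint_compr (x.π_star a)
  F := x.compr (x.ε * x.F)
  F_adjointable := by
    obtain ⟨S, hS⟩ := x.F_adjointable
    -- `ε` is self-adjoint, so `S ε` is the adjoint of `ε F`.
    refine ⟨x.compr (S * x.ε), x.isAdjoint_compr fun e f => ?_⟩
    change ⟪x.ε (x.F e), f⟫_(CliffordTensor B) = ⟪e, S (x.ε f)⟫_(CliffordTensor B)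
    rw [← hS, inner_eps, eps_inner]
  compact_sq a := by
    -- `(ε F)² = F²`, because `ε` commutes with `F` and squares to one.
    convert x.compr_mem_compacts (x.compact_sq a) using 1
    ext1 e
    change x.compr (x.π a) (x.compr (x.ε * x.F) (x.compr (x.ε * x.F) e) - e) =
      x.evenProj (x.π a (x.F (x.F e) - e))
    rw [compr_apply, Submodule.coe_sub, x.coe_compr x.εF_γ, x.coe_compr x.εF_γ]
    change x.evenProj (x.π a (x.ε (x.F (x.ε (x.F e))) - e)) = _
    rw [← ε_F, eps_eps]
  compact_commutator a := by
    -- `[π a, ε F] = ε [π a, F]`, because `ε` commutes with `π a`.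
    convert x.compr_mem_compacts
      (eps_mul_mem_compacts x.countablyGenerated (x.compact_commutator a)) using 1
    ext1 e
    change x.compr (x.π a) (x.compr (x.ε * x.F) e) - x.compr (x.ε * x.F) (x.compr (x.π a) e) =
      x.evenProj (x.ε (x.π a (x.F e) - x.F (x.π a e)))
    rw [x.compr_apply (x.π a), x.coe_compr x.εF_γ, x.compr_apply (x.ε * x.F),
      x.coe_compr (x.π_even a), map_sub, map_sub, ε_π]
    rfl

end KasparovModule

end EvenPart

/-! ### Compatibility with pushforwards -/

namespace IsPushforward

variable {A : Type u} {B C : Type v} [NonUnitalCStarAlgebra A] [NonUnitalCStarAlgebra B]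
  [NonUnitalCStarAlgebra C] {g : B →⋆ₙₐ[ℂ] C} {x : UngradedKasparovModule A B}
  {y : UngradedKasparovModule A C} {τ : x.carrier → C → y.carrier}

/-- The vectors `τ e c` span a dense subspace, so only zero is orthogonal to all of them.
Bilinearity of `τ` is not part of `IsPushforward`; it follows from the inner product formula by this
test. -/
theorem ext_inner (h : IsPushforward g x y τ) {w w' : y.carrier}
    (hw : ∀ e c, ⟪τ e c, w⟫_C = ⟪τ e c, w'⟫_C) : w = w' := by
  have h1 : (Submodule.span ℂ {z | ∃ e c, z = τ e c}).topologicalClosure ≤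
      LinearMap.ker ((HilbertModule.innerL C y.carrier (w - w') : y.carrier →ₗ[ℂ] C)) := by
    refine Submodule.topologicalClosure_minimal _ (Submodule.span_le.mpr ?_)
      (isClosed_singleton.preimage (HilbertModule.innerL C y.carrier (w - w')).continuous)
    rintro _ ⟨e, c, rfl⟩
    change ⟪w - w', τ e c⟫_C = 0
    rw [← HilbertModule.star_inner, HilbertModule.inner_sub_right, hw, sub_self, star_zero]
  rw [h.dense] at h1
  exact sub_eq_zero.mp (HilbertModule.inner_self_eq_zero (B := C) _
    (h1 (Submodule.mem_top (x := w - w'))))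

theorem add_left (h : IsPushforward g x y τ) (e e' : x.carrier) (c : C) :
    τ (e + e') c = τ e c + τ e' c :=
  h.ext_inner fun f d => by
    simp only [h.inner_eq, HilbertModule.inner_add_right, map_add, add_mul, mul_add]

theorem smul_left (h : IsPushforward g x y τ) (k : ℂ) (e : x.carrier) (c : C) :
    τ (k • e) c = k • τ e c :=
  h.ext_inner fun f d => by
    simp only [h.inner_eq, HilbertModule.inner_smul_right, map_smul, smul_mul_assoc,
      mul_smul_comm]

theorem zero_left (h : IsPushforward g x y τ) (c : C) : τ 0 c = 0 := by
  simpa using h.smul_left 0 0 c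

theorem neg_left (h : IsPushforward g x y τ) (e : x.carrier) (c : C) : τ (-e) c = -τ e c := by
  simpa using h.smul_left (-1) e c

theorem add_right (h : IsPushforward g x y τ) (e : x.carrier) (c c' : C) :
    τ e (c + c') = τ e c + τ e c' :=
  h.ext_inner fun f d => by simp only [h.inner_eq, HilbertModule.inner_add_right, mul_add]

theorem smul_right (h : IsPushforward g x y τ) (k : ℂ) (e : x.carrier) (c : C) :
    τ e (k • c) = k • τ e c :=
  h.ext_inner fun f d => by
    simp only [h.inner_eq, HilbertModule.inner_smul_right, mul_smul_comm]

theorem zero_right (h : IsPushforward g x y τ) (e : x.carrier) : τ e 0 = 0 := by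
  simpa using h.smul_right 0 e 0

theorem neg_right (h : IsPushforward g x y τ) (e : x.carrier) (c : C) : τ e (-c) = -τ e c := by
  simpa using h.smul_right (-1) e c

/-- The map `τ ⊗ C₁`. -/
def cliffordMap (τ : x.carrier → C → y.carrier) (e : CliffordModule x.carrier)
    (c : CliffordTensor C) : CliffordModule y.carrier :=
  ⟨τ e.even c.even + τ e.odd c.odd, τ e.even c.odd + τ e.odd c.even⟩

theorem tensorClifford (h : IsPushforward g x y τ) :
    IsPushforward (CliffordTensor.mapHom g) x.tensorClifford.toUngradedKasparovModule
      y.tensorClifford.toUngradedKasparovModule (cliffordMap τ) where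
  inner_eq (e e' : CliffordModule x.carrier) c c' := by
    change ⟪cliffordMap τ e c, cliffordMap τ e' c'⟫_(CliffordTensor C) =
      star c * (CliffordTensor.mapHom g ⟪e, e'⟫_(CliffordTensor B) * c')
    ext <;>
    · simp only [cliffordMap, CliffordModule.even_inner, CliffordModule.odd_inner,
        HilbertModule.inner_add_left, HilbertModule.inner_add_right, h.inner_eq,
        CliffordTensor.even_mul, CliffordTensor.odd_mul, CliffordTensor.even_star,
        CliffordTensor.odd_star, CliffordTensor.even_mapHom, CliffordTensor.odd_mapHom, map_add,
        add_mul, mul_add]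
      abel
  dense := by
    suffices key : (Submodule.span ℂ {z : CliffordModule y.carrier |
        ∃ (e : CliffordModule x.carrier) (c : CliffordTensor C),
          z = cliffordMap τ e c}).topologicalClosure = ⊤ from key
    refine eq_top_iff.mpr fun z _ => ?_
    have h3 : z = CliffordModule.tmulOne z.even + CliffordModule.tmulEps z.odd := by ext <;> simp
    rw [h3]
    refine add_mem ?_ ?_
    · refine map_closure_le CliffordModule.tmulOne _ _ ?_
        (h.dense.ge (Submodule.mem_top (x := z.even)))
      rintro _ ⟨e, c, rfl⟩
      -- Coefficients `c ⊗ 1` suffice: the degree of the vector `e ⊗ 1` or `e ⊗ ε` already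
      -- determines that of the image.
      refine Submodule.le_topologicalClosure _ (Submodule.subset_span
        ⟨⟨e, 0⟩, ⟨c, 0⟩, CliffordModule.ext ?_ ?_⟩)
      · simp [cliffordMap, h.zero_left]
      · simp [cliffordMap, h.zero_left, h.zero_right]
    · refine map_closure_le CliffordModule.tmulEps _ _ ?_
        (h.dense.ge (Submodule.mem_top (x := z.odd)))
      rintro _ ⟨e, c, rfl⟩
      refine Submodule.le_topologicalClosure _ (Submodule.subset_span
        ⟨⟨0, e⟩, ⟨c, 0⟩, CliffordModule.ext ?_ ?_⟩)
      · simp [cliffordMap, h.zero_left, h.zero_right]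
      · simp [cliffordMap, h.zero_left]
  map_π a (e : CliffordModule x.carrier) c := CliffordModule.ext
    (by
      change τ (x.π a e.even) c.even + τ (x.π a e.odd) c.odd =
        y.π a (τ e.even c.even + τ e.odd c.odd)
      rw [h.map_π, h.map_π, map_add])
    (by
      change τ (x.π a e.even) c.odd + τ (x.π a e.odd) c.even =
        y.π a (τ e.even c.odd + τ e.odd c.even)
      rw [h.map_π, h.map_π, map_add])
  map_F (e : CliffordModule x.carrier) c := CliffordModule.ext
    (by
      change τ (x.F e.odd) c.even + τ (x.F e.even) c.odd = y.F (τ e.even c.odd + τ e.odd c.even)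
      rw [h.map_F, h.map_F, map_add, add_comm])
    (by
      change τ (x.F e.odd) c.odd + τ (x.F e.even) c.even = y.F (τ e.even c.even + τ e.odd c.odd)
      rw [h.map_F, h.map_F, map_add, add_comm])

theorem cliffordMap_γ (h : IsPushforward g x y τ) (e : CliffordModule x.carrier)
    (c : CliffordTensor C) :
    cliffordMap τ (CliffordModule.gradeL e) (gradeHom c) =
      CliffordModule.gradeL (cliffordMap τ e c) := by
  ext
  · simp [cliffordMap, h.neg_left, h.neg_right]
  · simp [cliffordMap, h.neg_left, h.neg_right, add_comm]

end IsPushforward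

/-! ### Pushforwards along `g ⊗ 1` and the even part. -/

section EvenPushforward

open CliffordTensor

variable {A : Type u} {B C : Type v} [NonUnitalCStarAlgebra A] [NonUnitalCStarAlgebra B]
  [NonUnitalCStarAlgebra C] {g : B →⋆ₙₐ[ℂ] C} {x : KasparovModule A (CliffordTensor B)}
  {y : KasparovModule A (CliffordTensor C)} {τ : x.carrier → CliffordTensor C → y.carrier}

/-- `g ⊗ 1` respects multiplication by `1 ⊗ ε`, which is central in the target. So `ε` can be moved
freely between the vector, the coefficient and the tensor; `apply_swap` is the other half. -/
theorem IsPushforward.map_ε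
    (h : IsPushforward (mapHom g) x.toUngradedKasparovModule y.toUngradedKasparovModule τ)
    (e : x.carrier) (c : CliffordTensor C) : τ (x.ε e) c = y.ε (τ e c) :=
  h.ext_inner fun f d => by
    rw [h.inner_eq, inner_eps, inner_eps, h.inner_eq, mapHom_swap, swap_mul, mul_swap]

theorem IsPushforward.apply_swap
    (h : IsPushforward (mapHom g) x.toUngradedKasparovModule y.toUngradedKasparovModule τ)
    (e : x.carrier) (c : CliffordTensor C) : τ e (swap c) = τ (x.ε e) c :=
  h.ext_inner fun f d => by
    rw [h.inner_eq, h.inner_eq, inner_eps, mapHom_swap, swap_mul, mul_swap]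

/-- The new map is the restriction of `τ` to vectors of degree zero and coefficients in `C ⊗ 1`.
Compatibility with the gradings, `hγ`, puts its values in degree zero. -/
theorem IsPushforward.evenPart
    (h : IsPushforward (mapHom g) x.toUngradedKasparovModule y.toUngradedKasparovModule τ)
    (hγ : ∀ e c, τ (x.γ e) (gradeHom c) = y.γ (τ e c)) :
    ∃ τ' : x.evenPart.carrier → C → y.evenPart.carrier,
      IsPushforward g x.evenPart y.evenPart τ' := by
  have hγ' (e : x.carrier) (c : C) : τ (x.γ e) (ofEven c) = y.γ (τ e (ofEven c)) := by
    rw [← hγ, gradeHom_ofEven]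
  let τ₀ : x.evenSubmodule → C → y.evenSubmodule := fun e c => ⟨τ e (ofEven c), by
    change y.γ _ = _
    rw [← hγ', e.2]⟩
  have hτ (e : x.carrier) (c : C) : y.evenProj (τ e (ofEven c)) = τ₀ (x.evenProj e) c :=
    Subtype.ext <| by
      change _ = τ (x.evenProj e) (ofEven c)
      rw [y.coe_evenProj, x.coe_evenProj, h.smul_left, h.add_left, hγ']
  refine ⟨τ₀, ?_, ?_, ?_, ?_⟩
  · intro (e : x.evenSubmodule) (e' : x.evenSubmodule) c c'
    change (⟪τ e (ofEven c), τ e' (ofEven c')⟫_(CliffordTensor C)).even =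
      star c * (g ⟪e, e'⟫_B * c')
    rw [h.inner_eq, x.inner_coe]
    simp
  · change (Submodule.span ℂ {z : y.evenSubmodule | ∃ e c, z = τ₀ e c}).topologicalClosure = ⊤
    refine eq_top_iff.mpr fun z _ => ?_
    rw [← y.evenProj_coe z]
    refine map_closure_le y.evenProj _ _ ?_ (h.dense.ge (Submodule.mem_top (x := z.1)))
    rintro _ ⟨e, c, rfl⟩
    refine Submodule.le_topologicalClosure _ ?_
    -- Moving `ε` onto the vector leaves only even coefficients, for which the projection commutes
    -- with `τ`. The projected generator is thus a sum of two values of `τ₀`.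
    rw [eq_ofEven_add_swap c, h.add_right, h.apply_swap, map_add, hτ, hτ]
    exact add_mem (Submodule.subset_span ⟨_, _, rfl⟩) (Submodule.subset_span ⟨_, _, rfl⟩)
  · intro a (e : x.evenSubmodule) c
    refine Subtype.ext ?_
    change τ (x.compr (x.π a) e) (ofEven c) = (y.compr (y.π a) (τ₀ e c) : y.carrier)
    rw [x.coe_compr (x.π_even a), y.coe_compr (y.π_even a)]
    exact h.map_π a e (ofEven c)
  · intro (e : x.evenSubmodule) c
    refine Subtype.ext ?_
    change τ (x.compr (x.ε * x.F) e) (ofEven c) = (y.compr (y.ε * y.F) (τ₀ e c) : y.carrier)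
    rw [x.coe_compr x.εF_γ, y.coe_compr y.εF_γ]
    exact (h.map_ε _ _).trans (congrArg y.ε (h.map_F _ _))

end EvenPushforward

/-! ### The isomorphism -/

section Main

open CliffordTensor

variable {A : Type u} {B : Type v} [NonUnitalCStarAlgebra A] [NonUnitalCStarAlgebra B]

/-- For a homotopy `k`, the module `k ⊗ C₁` lives over `C([0, 1], B) ⊗ C₁`. The isomorphism with
`C([0, 1], B ⊗ C₁)` turns `g ⊗ 1`, for `g` an evaluation, into the evaluation. -/
theorem UngradedKasparovModule.Homotopic.tensorClifford {x y : UngradedKasparovModule A B}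
    (h : x.Homotopic y) : x.tensorClifford.Homotopic y.tensorClifford := by
  obtain ⟨k, ⟨τ, h0⟩, ⟨τ', h1⟩⟩ := h
  exact ⟨k.tensorClifford.congr continuousMapEquiv continuousMapEquiv_gradeHom,
    ⟨_, h0.tensorClifford.congr continuousMapEquiv fun _ => rfl, h0.cliffordMap_γ⟩,
    ⟨_, h1.tensorClifford.congr continuousMapEquiv fun _ => rfl, h1.cliffordMap_γ⟩⟩

theorem KasparovModule.Homotopic.evenPart {x y : KasparovModule A (CliffordTensor B)}
    (h : x.Homotopic y) : x.evenPart.Homotopic y.evenPart := by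
  obtain ⟨k, ⟨τ, h0, g0⟩, ⟨τ', h1, g1⟩⟩ := h
  let k' : KasparovModule A (CliffordTensor C(I, B)) :=
    k.congr continuousMapEquiv.symm fun _ => rfl
  have h0' : IsPushforward (mapHom (evalAt B 0)) k'.toUngradedKasparovModule
      x.toUngradedKasparovModule τ := h0.congr continuousMapEquiv.symm fun _ => rfl
  have h1' : IsPushforward (mapHom (evalAt B 1)) k'.toUngradedKasparovModule
      y.toUngradedKasparovModule τ' := h1.congr continuousMapEquiv.symm fun _ => rfl
  exact ⟨k'.evenPart, h0'.evenPart g0, h1'.evenPart g1⟩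

/-- The map `e + f ⊗ ε ↦ e + f ε` from `E₀ ⊗ C₁` to `E`. -/
def KasparovModule.ofEvenPart (x : KasparovModule A (CliffordTensor B)) :
    CliffordModule x.evenSubmodule →L[ℂ] x.carrier :=
  x.evenSubmodule.subtypeL ∘L CliffordModule.evenL +
    x.ε ∘L x.evenSubmodule.subtypeL ∘L CliffordModule.oddL

/-- Surjectivity is `E = E₀ ⊕ E₀ ε`. For the operators, `(ε F) ⊗ ε` sends `e + f ⊗ ε` to `ε F f + (ε
F e) ⊗ ε`, whose image in `E` is `F (e + f ε)` because `ε² = 1`. -/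
theorem KasparovModule.isUnitaryEquiv_ofEvenPart (x : KasparovModule A (CliffordTensor B)) :
    IsUnitaryEquiv x.evenPart.tensorClifford.toUngradedKasparovModule x.toUngradedKasparovModule
      x.ofEvenPart where
  inner_map (e e' : CliffordModule x.evenSubmodule) := by
    change ⟪e.even.1 + x.ε e.odd.1, e'.even.1 + x.ε e'.odd.1⟫_(CliffordTensor B) =
      ⟪e, e'⟫_(CliffordTensor B)
    rw [HilbertModule.inner_add_left,
      HilbertModule.inner_add_right, HilbertModule.inner_add_right, inner_eps, eps_inner,
      eps_inner, inner_eps, swap_swap, x.inner_coe, x.inner_coe, x.inner_coe, x.inner_coe]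
    ext <;> simp
  surjective e := by
    refine ⟨⟨x.evenProj e, x.evenProj (x.ε e)⟩, ?_⟩
    exact (x.eq_evenProj_add e).symm
  map_π a (e : CliffordModule x.evenSubmodule) := by
    change (x.compr (x.π a) e.even : x.carrier) + x.ε (x.compr (x.π a) e.odd : x.carrier) =
      x.π a (e.even.1 + x.ε e.odd.1)
    rw [x.coe_compr (x.π_even a), x.coe_compr (x.π_even a), map_add, ε_π]
  map_F (e : CliffordModule x.evenSubmodule) := by
    change (x.compr (x.ε * x.F) e.odd : x.carrier) +
      x.ε (x.compr (x.ε * x.F) e.even : x.carrier) = x.F (e.even.1 + x.ε e.odd.1)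
    rw [x.coe_compr x.εF_γ, x.coe_compr x.εF_γ, map_add, ← ε_F, add_comm]
    congr 1
    exact eps_eps _ _

theorem KasparovModule.tensorClifford_evenPart_homotopic
    (x : KasparovModule A (CliffordTensor B)) : x.evenPart.tensorClifford.Homotopic x :=
  x.isUnitaryEquiv_ofEvenPart.homotopic_graded fun (e : CliffordModule x.evenSubmodule) => by
    change e.even.1 + x.ε ((-e.odd : x.evenSubmodule) : x.carrier) =
      x.γ (e.even.1 + x.ε e.odd.1)
    rw [map_add, x.γ_ε, e.even.2, e.odd.2, Submodule.coe_neg, map_neg]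

/-- The map `e ↦ e ⊗ 1` from `E` to the part of degree `0` of `E ⊗ C₁`. -/
def UngradedKasparovModule.toEvenPart (x : UngradedKasparovModule A B) :
    x.carrier →L[ℂ] x.tensorClifford.evenSubmodule :=
  (CliffordModule.tmulOne (E := x.carrier)).codRestrict x.tensorClifford.evenSubmodule fun _ =>
    CliffordModule.ext rfl neg_zero

theorem UngradedKasparovModule.tensorClifford_ε_apply (x : UngradedKasparovModule A B)
    (e : CliffordModule x.carrier) : x.tensorClifford.ε e = (⟨e.odd, e.even⟩ :
      CliffordModule x.carrier) :=
  eps_eq x.tensorClifford.countablyGenerated (y := (⟨e.odd, e.even⟩ : CliffordModule x.carrier))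
    fun _ => CliffordTensor.ext rfl rfl

/-- The part of degree zero of `E ⊗ C₁` is `E ⊗ 1`, and right multiplication by `ε` after `F ⊗ ε` is
`F ⊗ 1`. -/
theorem UngradedKasparovModule.isUnitaryEquiv_toEvenPart (x : UngradedKasparovModule A B) :
    IsUnitaryEquiv x x.tensorClifford.evenPart x.toEvenPart where
  inner_map e e' := by
    change ⟪e, e'⟫_B + ⟪(0 : x.carrier), (0 : x.carrier)⟫_B = _
    rw [HilbertModule.inner_zero_left, add_zero]
  surjective := by
    intro (e : x.tensorClifford.evenSubmodule)
    obtain ⟨(e : CliffordModule x.carrier), he⟩ := e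
    have h1 : -e.odd = e.odd := congrArg CliffordModule.odd he
    have h2 : e.odd = 0 := by
      rw [← CliffordModule.half_add_half e.odd]
      nth_rw 1 [← h1]
      rw [smul_neg, neg_add_cancel]
    exact ⟨e.even, Subtype.ext (CliffordModule.ext rfl h2.symm)⟩
  map_π a e := Subtype.ext <| by
    refine Eq.trans ?_ (x.tensorClifford.coe_compr (x.tensorClifford.π_even a) _).symm
    exact CliffordModule.ext rfl (map_zero (x.π a)).symm
  map_F e := Subtype.ext <| by
    refine Eq.trans ?_ (x.tensorClifford.coe_compr x.tensorClifford.εF_γ _).symm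
    refine Eq.trans ?_ (x.tensorClifford_ε_apply _).symm
    exact CliffordModule.ext rfl (map_zero x.F).symm

/-- The unitary equivalence `(E ⊕ E') ⊗ C₁ ≅ (E ⊗ C₁) ⊕ (E' ⊗ C₁)`. -/
def cliffordSum (x y : UngradedKasparovModule A B) :
    CliffordModule (HSum B x.carrier y.carrier) →L[ℂ]
      HSum (CliffordTensor B) (CliffordModule x.carrier) (CliffordModule y.carrier) where
  toFun e := ⟨⟨e.even.fst, e.odd.fst⟩, ⟨e.even.snd, e.odd.snd⟩⟩
  map_add' _ _ := rfl
  map_smul' _ _ := rfl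
  cont := (HSum.inlL ∘L (CliffordModule.tmulOne ∘L HSum.fstL ∘L CliffordModule.evenL +
      CliffordModule.tmulEps ∘L HSum.fstL ∘L CliffordModule.oddL) +
    HSum.inrL ∘L (CliffordModule.tmulOne ∘L HSum.sndL ∘L CliffordModule.evenL +
      CliffordModule.tmulEps ∘L HSum.sndL ∘L CliffordModule.oddL)).continuous.congr
    fun _ => by ext <;> simp

theorem isUnitaryEquiv_cliffordSum (x y : UngradedKasparovModule A B) :
    IsUnitaryEquiv (x.sum y).tensorClifford.toUngradedKasparovModule
      (x.tensorClifford.sum y.tensorClifford).toUngradedKasparovModule (cliffordSum x y) where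
  inner_map _ _ := CliffordTensor.ext (add_add_add_comm _ _ _ _) (add_add_add_comm _ _ _ _)
  surjective (e : HSum (CliffordTensor B) (CliffordModule x.carrier) (CliffordModule y.carrier)) :=
    ⟨(⟨⟨e.fst.even, e.snd.even⟩, ⟨e.fst.odd, e.snd.odd⟩⟩ :
      CliffordModule (HSum B x.carrier y.carrier)), rfl⟩
  map_π _ _ := rfl
  map_F _ := rfl

theorem tensorClifford_sum_homotopic (x y : UngradedKasparovModule A B) :
    (x.sum y).tensorClifford.Homotopic (x.tensorClifford.sum y.tensorClifford) :=
  (isUnitaryEquiv_cliffordSum x y).homotopic_graded fun _ => rfl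

variable (A B) in
/-- The isomorphism between the homotopy classes of ungraded Kasparov `A`-`B`-modules and
`KK(A, B ⊗ C₁)`. -/
def ungradedKKEquiv : UngradedKK A B ≃+ KK A (CliffordTensor B) where
  toFun := Quot.map UngradedKasparovModule.tensorClifford fun _ _ h => h.tensorClifford
  invFun := Quot.map KasparovModule.evenPart fun _ _ h => h.evenPart
  left_inv := by
    rintro ⟨x⟩
    -- The unitary runs from `x` to its image, against the direction of the identity to be shown;
    -- symmetry is taken of the equality of classes, not of the homotopy.
    exact (Quot.sound x.isUnitaryEquiv_toEvenPart.homotopic).symm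
  right_inv := by
    rintro ⟨x⟩
    exact Quot.sound x.tensorClifford_evenPart_homotopic
  map_add' := by
    rintro ⟨x⟩ ⟨y⟩
    exact Quot.sound (tensorClifford_sum_homotopic x y)

end Main

end

end KKTheory

theorem mainTheorem7 (A : Type*) (B : Type*) [NonUnitalCStarAlgebra A] [NonUnitalCStarAlgebra B] :
    ∃ e : KKTheory.UngradedKK A B ≃+ KKTheory.KK A (KKTheory.CliffordTensor B),
      ∀ x : KKTheory.UngradedKasparovModule A B,
        e (KKTheory.UngradedKK.mk x) = KKTheory.KK.mk x.tensorClifford :=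
  ⟨KKTheory.ungradedKKEquiv A B, fun _ => rfl⟩
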